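/- **Setting.** Work in the category of all pointed topological spaces and continuous base point preserving maps; homotopies are relative to the base point. Let $I=[0,1]$. For a pointed space $X$ let $\mathbb{I}X=(X\times I)/(\{*\}\times I)$ be the reduced cylinder with bottom inclusion $i_0:X\to\mathbb{I}X$, $x\mapsto[x,0]$; let $\mathrm{C}X=(X\times I)/(\{*\}\times I\cup X\times\{0\})$ be the reduced cone with base inclusion $X\hookrightarrow \mathrm{C}X$, $x\mapsto[x,1]$; and let $\Sigma X=(X\times I)/(\{*\}\times I\cup X\times\{0,1\})$ be the reduced suspension. $\mathbb{I}^n$ and $\Sigma^n$ are the $n$-fold iterates, with $\mathbb{I}^0=\Sigma^0=\mathrm{id}$. Let $A$ be a pointed space. * For $n\ge 0$ put $\pi^A_n(X)=[\Sigma^nA,X]$ (pointed homotopy classes of pointed maps). A pointed map $f:X\to Y$ is an *$A$-weak equivalence* if $f_*:\pi^A_n(X)\to\pi^A_n(Y)$ is an isomorphism (equivalently, bijective) for all $n\ge 0$. * A pointed map is an *$A$-fibration* if it has the homotopy lifting property, in pointed spaces, with respect to $A$, to $\mathrm{C}\Sigma^{n-1}A$ for all $n\geq 1$, and to $\mathbb{I}^nA$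 for all $n\ge 1$. * A pointed map is an *$A$-cofibration* if it has the left lifting property with respect to all $A$-fibrations that are $A$-weak equivalences. * $\mathcal{I}_A=\{\Sigma^{n-1}A\hookrightarrow\mathrm{C}\Sigma^{n-1}A : n\ge 1\}\cup\{i_0:\mathbb{I}^{n-1}A\to\mathbb{I}^{n}A : n\geq 1\}\cup\{*\to A\}$. * $\mathcal{J}_A=\{i_0:\mathbb{I}^{n-1}A\to\mathbb{I}^{n}A : n\ge 1\}\cup\{i_0:\mathrm{C}\Sigma^{n-1}A\to\mathbb{I}\mathrm{C}\Sigma^{n-1}A : n\geq 1\}$. $A$ is an *H-cogroup* if it has a comultiplication $A\to A\vee A$ that is, up to pointed homotopy, coassociative, counital (with counit the constant map) and has a coinverse $A\to A$. **Theorem.** Let $A$ be a compact (not necessarily Hausdorff) $T_1$ H-cogroup. Then the category of pointed topological spaces, with the $A$-fibrations as fibrations, the $A$-cofibrations as cofibrations and the $A$-weak equivalences as weak equivalences, is a cofibrantly generated model category, with $\mathcal{I}_A$ as a set of generating cofibrations and $\mathcal{J}_A$ as a set of generating trivial cofibrations. Explicitly: the category has all small limits and colimits; the three classes satisfy the (closed)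 model category axioms, with functorial factorizations; $\mathcal{I}_A$ and $\mathcal{J}_A$ are sets of maps that permit the small object argument, i.e. the domains of the maps in $\mathcal{I}_A$ (resp. $\mathcal{J}_A$) are small relative to the relative $\mathcal{I}_A$-cell complexes (resp. relative $\mathcal{J}_A$-cell complexes); a map is both an $A$-fibration and an $A$-weak equivalence if and only if it has the right lifting property with respect to $\mathcal{I}_A$; and a map is an $A$-fibration if and only if it has the right lifting property with respect to $\mathcal{J}_A$. -/

import Mathlib

open CategoryTheory CategoryTheory.Limits HomotopicalAlgebra

universe w v u

noncomputable section

/-! ### Pointed topological spaces -/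

/-- The category of pointed topological spaces and continuous base point preserving maps,
as the category of topological spaces under the one-point space. -/
abbrev PtdTop : Type (u + 1) := Under (TopCat.of PUnit.{u + 1})

namespace PtdTop

/-- The underlying topological space of a pointed space. -/
abbrev Space (X : PtdTop.{u}) : TopCat.{u} := X.right

/-- The base point. -/
def pt (X : PtdTop.{u}) : Space X := X.hom PUnit.unit

/-- The underlying continuous map of a pointed map. -/
abbrev toMap {X Y : PtdTop.{u}} (f : X ⟶ Y) : C(Space X, Space Y) := f.right.hom

/-- The pointed space given by a topological space and one of its points. -/
def of (X : Type u) [TopologicalSpace X] (x₀ : X) : PtdTop.{u} :=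
  Under.mk (Y := TopCat.of X) (TopCat.ofHom (ContinuousMap.const _ x₀))

/-- The pointed map given by a continuous map that preserves the base points. -/
def ofMap {X Y : PtdTop.{u}} (f : C(Space X, Space Y)) (hf : f (pt X) = pt Y) : X ⟶ Y :=
  Under.homMk (TopCat.ofHom f) (by ext; exact hf)

/-- The constant map at the base point. -/
def const (X Y : PtdTop.{u}) : X ⟶ Y := ofMap (ContinuousMap.const _ (pt Y)) rfl

/-- The one-point space `∗`. -/
def point : PtdTop.{u} := of PUnit.{u + 1} PUnit.unit

/-! ### Reduced cylinders, cones and suspensions -/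

/-- The equivalence relation that identifies all the points of `S` with each other. -/
def collapse {Z : Type u} (S : Set Z) : Setoid Z where
  r x y := x = y ∨ (x ∈ S ∧ y ∈ S)
  iseqv := by
    refine ⟨fun x => Or.inl rfl, ?_, ?_⟩
    · rintro x y (h | h)
      · exact Or.inl h.symm
      · exact Or.inr ⟨h.2, h.1⟩
    · rintro x y z (rfl | h) (rfl | k)
      · exact Or.inl rfl
      · exact Or.inr k
      · exact Or.inr h
      · exact Or.inr ⟨h.1, k.2⟩

/-- The reduced cylinder `𝕀X = (X × I) / ({∗} × I)`, with the quotient topology. -/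
def cyl (X : PtdTop.{u}) : PtdTop.{u} :=
  of (Quotient (collapse {z : Space X × unitInterval | z.1 = pt X}))
    (Quotient.mk _ (pt X, 0))

/-- The reduced cone `CX = (X × I) / ({∗} × I ∪ X × {0})`, with the quotient topology. -/
def cone (X : PtdTop.{u}) : PtdTop.{u} :=
  of (Quotient (collapse {z : Space X × unitInterval | z.1 = pt X ∨ z.2 = 0}))
    (Quotient.mk _ (pt X, 0))

/-- The reduced suspension `ΣX = (X × I) / ({∗} × I ∪ X × {0, 1})`, with the quotient
topology. -/
def susp (X : PtdTop.{u}) : PtdTop.{u} :=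
  of (Quotient (collapse {z : Space X × unitInterval | z.1 = pt X ∨ z.2 = 0 ∨ z.2 = 1}))
    (Quotient.mk _ (pt X, 0))

/-- The inclusion `i₀ : X → 𝕀X`, `x ↦ [x, 0]`, of the bottom of the cylinder. -/
def i₀ (X : PtdTop.{u}) : X ⟶ cyl X :=
  ofMap ⟨fun x => Quotient.mk _ (x, 0),
    continuous_quotient_mk'.comp (continuous_id.prodMk continuous_const)⟩ rfl

/-- The inclusion `X → CX`, `x ↦ [x, 1]`, of the base of the cone. -/
def coneIncl (X : PtdTop.{u}) : X ⟶ cone X :=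
  ofMap ⟨fun x => Quotient.mk _ (x, 1),
    continuous_quotient_mk'.comp (continuous_id.prodMk continuous_const)⟩
    (Quotient.sound (Or.inr ⟨Or.inl rfl, Or.inl rfl⟩))

/-- The iterated reduced cylinder `𝕀ⁿX`. -/
def cylIter (X : PtdTop.{u}) : ℕ → PtdTop.{u}
  | 0 => X
  | n + 1 => cyl (cylIter X n)

/-- The iterated reduced suspension `ΣⁿX`. -/
def suspIter (X : PtdTop.{u}) : ℕ → PtdTop.{u}
  | 0 => X
  | n + 1 => susp (suspIter X n)

/-! ### Pointed homotopies and H-cogroups -/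

/-- Homotopy of pointed maps, relative to the base point. -/
def Homotopic {X Y : PtdTop.{u}} (f g : X ⟶ Y) : Prop :=
  (toMap f).HomotopicRel (toMap g) {pt X}

/-- Pointed homotopy as an equivalence relation on pointed maps. -/
def homotopySetoid (X Y : PtdTop.{u}) : Setoid (X ⟶ Y) where
  r := Homotopic
  iseqv := ⟨fun f => .refl (toMap f), fun h => .symm h, fun h k => .trans h k⟩

/-- The set `[X, Y]` of pointed homotopy classes of pointed maps. -/
def HomotopyClasses (X Y : PtdTop.{u}) : Type u := Quotient (homotopySetoid X Y)

/-- The map `[X, E] → [X, B]` induced by composition with `p : E ⟶ B`. -/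
def HomotopyClasses.map (X : PtdTop.{u}) {E B : PtdTop.{u}} (p : E ⟶ B) :
    HomotopyClasses X E → HomotopyClasses X B :=
  Quotient.map' (fun f => f ≫ p)
    (fun _ _ h => ContinuousMap.HomotopicRel.comp_continuousMap h (toMap p))

/-- `A` is an H-cogroup: up to pointed homotopy there are a counital (with counit the constant
map) coassociative comultiplication `A → A ∨ A` and a coinverse `A → A`. The coproduct `A ⨿ A`
in pointed spaces is the wedge `A ∨ A`. -/
def IsHCogroup (A : PtdTop.{u}) : Prop :=
  ∃ (μ : A ⟶ A ⨿ A) (ν : A ⟶ A),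
    Homotopic (μ ≫ coprod.desc (const A A) (𝟙 A)) (𝟙 A) ∧
    Homotopic (μ ≫ coprod.desc (𝟙 A) (const A A)) (𝟙 A) ∧
    Homotopic (μ ≫ coprod.map μ (𝟙 A) ≫ (coprod.associator A A A).hom)
      (μ ≫ coprod.map (𝟙 A) μ) ∧
    Homotopic (μ ≫ coprod.desc ν (𝟙 A)) (const A A) ∧
    Homotopic (μ ≫ coprod.desc (𝟙 A) ν) (const A A)

/-! ### The three classes of maps and the generating sets -/

/-- `πₙᴬ(X) = [ΣⁿA, X]`. -/
abbrev piA (A : PtdTop.{u}) (n : ℕ) (X : PtdTop.{u}) : Type u :=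
  HomotopyClasses (suspIter A n) X

/-- `A`-weak equivalences: maps that induce isomorphisms on `πₙᴬ` for all `n ≥ 0`. (The induced
maps are homomorphisms for the group structures coming from the cogroup structures on `ΣⁿA`, so
that being an isomorphism is being bijective.) -/
def weakEquivalencesA (A : PtdTop.{u}) : MorphismProperty PtdTop.{u} :=
  fun E B p => ∀ n : ℕ, Function.Bijective
    (HomotopyClasses.map (suspIter A n) p : piA A n E → piA A n B)

/-- `p` has the (pointed) homotopy lifting property with respect to `X`. -/
def HasHLP {E B : PtdTop.{u}} (p : E ⟶ B) (X : PtdTop.{u}) : Prop :=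
  ∀ (f : X ⟶ E) (H : cyl X ⟶ B), i₀ X ≫ H = f ≫ p →
    ∃ G : cyl X ⟶ E, i₀ X ≫ G = f ∧ G ≫ p = H

/-- `A`-fibrations: maps with the homotopy lifting property with respect to
`A`, `CΣⁿ⁻¹A` (`n ≥ 1`) and `𝕀ⁿA` (`n ≥ 1`). -/
def fibrationsA (A : PtdTop.{u}) : MorphismProperty PtdTop.{u} :=
  fun _ _ p => HasHLP p A ∧ (∀ n : ℕ, HasHLP p (cone (suspIter A n))) ∧
    ∀ n : ℕ, HasHLP p (cylIter A (n + 1))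

/-- `A`-cofibrations: maps with the left lifting property with respect to the `A`-fibrations
that are `A`-weak equivalences. -/
def cofibrationsA (A : PtdTop.{u}) : MorphismProperty PtdTop.{u} :=
  (fibrationsA A ⊓ weakEquivalencesA A).llp

/-- The set `I_A` (the indices `n` here are the `n - 1` of the usual numbering from `1`). -/
inductive genCofibrations (A : PtdTop.{u}) : MorphismProperty PtdTop.{u}
  | cone (n : ℕ) : genCofibrations A (coneIncl (suspIter A n))
  | cyl (n : ℕ) : genCofibrations A (i₀ (cylIter A n))
  | point : genCofibrations A (const point A)

/-- The set `J_A` (the indices `n` here are the `n - 1` of the usual numbering from `1`). -/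
inductive genTrivialCofibrations (A : PtdTop.{u}) : MorphismProperty PtdTop.{u}
  | cyl (n : ℕ) : genTrivialCofibrations A (i₀ (cylIter A n))
  | cylCone (n : ℕ) : genTrivialCofibrations A (i₀ (PtdTop.cone (suspIter A n)))

end PtdTop

/-! ### Cofibrantly generated model categories -/

section CofibrantGeneration

variable {C : Type u} [Category.{v} C]

/-- The relative `I`-cell complexes: transfinite compositions of pushouts of elements of `I`. -/
def relativeCellComplexes (I : MorphismProperty C) : MorphismProperty C :=
  MorphismProperty.transfiniteCompositions.{w} I.pushouts

/-- The object `W` is small relative to the class `D`: there is a cardinal `κ` such that for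
every regular cardinal `l ≥ κ` and every `l`-sequence `X₀ ⟶ X₁ ⟶ ⋯ ⟶ X_β ⟶ ⋯` (`β < l`) whose
maps `X_β ⟶ X_{β+1}` are in `D`, the functor `Hom(W, -)` commutes with its colimit. -/
def IsSmallRelativeTo (D : MorphismProperty C) (W : C) : Prop :=
  ∃ κ : Cardinal.{w}, ∀ (l : Cardinal.{w}), κ ≤ l → l.IsRegular →
    ∀ [OrderBot l.ord.ToType] {X Y : C} (f : X ⟶ Y)
      (c : D.TransfiniteCompositionOfShape l.ord.ToType f),
      PreservesColimit c.F (coyoneda.obj (Opposite.op W))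

/-- `I` permits the small object argument: the domains of the elements of `I` are small
relative to the relative `I`-cell complexes. -/
def PermitsSmallObjectArgument (I : MorphismProperty C) : Prop :=
  ∀ ⦃X Y : C⦄ (i : X ⟶ Y), I i → IsSmallRelativeTo.{w} (relativeCellComplexes.{w} I) X

/-- The model category `C` is cofibrantly generated, with `I` as a set of generating
cofibrations and `J` as a set of generating trivial cofibrations. -/
structure IsCofibrantlyGeneratedBy (C : Type u) [Category.{v} C] [ModelCategory C]
    (I J : MorphismProperty C) : Prop where
  /-- `I` is a set. -/
  isSmall_I : MorphismProperty.IsSmall.{w} I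
  /-- `J` is a set. -/
  isSmall_J : MorphismProperty.IsSmall.{w} J
  permits_I : PermitsSmallObjectArgument.{w} I
  permits_J : PermitsSmallObjectArgument.{w} J
  /-- The trivial fibrations are the maps with the right lifting property against `I`. -/
  trivialFibrations_eq : trivialFibrations C = I.rlp
  /-- The fibrations are the maps with the right lifting property against `J`. -/
  fibrations_eq : fibrations C = J.rlp

end CofibrantGeneration

end

namespace PtdTop

/-! ### Pointed maps -/

/-! Write I and J for the two generating sets and W for the `A`-weak equivalences. The
`A`-fibrations are J.rlp by definition, so the recognition criterion `exists_modelCategory` leaves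
three tasks: functorial factorizations, I.rlp = J.rlp ∩ W, and J.rlp.llp ≤ W.

Factorizations come from the small object argument. The generators are topological embeddings, and
embeddings are characterized by a left lifting property (`isEmbedding_of_llp`,
`llp_of_isEmbedding`), so all relative cell complexes are embeddings. Along a chain of embeddings
indexed by a large regular cardinal, a map from any fixed space factors through a stage: counting
points gives the factorization, and the embedding property makes it continuous
(`preservesColimit_coyoneda`).

For J.rlp.llp ≤ W, the maps `Y ⟶ point` and the end point maps of path spaces have the homotopy
lifting property for every space. Lifting against them turns a map in J.rlp.llp into the inclusion
of a deformation retract.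

The core is I.rlp = J.rlp ∩ W. Lifting against ΣX → CΣX means filling a square of maps with trivial
left side and the other three sides prescribed (`exists_lift_square`). This yields homotopy lifting
for cones and injectivity on `piA A n` for n ≥ 1. For n = 0 there is no suspension coordinate, and
the cogroup structure upgrades trivial kernel to injectivity (`IsHCogroup.homotopic_of_comp`).
Conversely, in `hasLiftingProperty_coneIncl`, injectivity makes the given map on the base
null-homotopic. The null-homotopy and the given map on the cone glue to a map on a suspension, which
lifts by surjectivity, and a homotopy lifted relative to the base corrects the result. -/

lemma hom_ext {X Y : PtdTop.{u}} {f g : X ⟶ Y} (h : ∀ x, toMap f x = toMap g x) : f = g := by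
  apply Under.UnderMorphism.ext
  ext x
  exact h x

@[simp] lemma toMap_pt {X Y : PtdTop.{u}} (f : X ⟶ Y) : toMap f (pt X) = pt Y := by
  have h := congrArg (fun g : TopCat.of PUnit.{u + 1} ⟶ Y.right => g PUnit.unit) (Under.w f)
  exact h

lemma comp_apply {X Y Z : PtdTop.{u}} (f : X ⟶ Y) (g : Y ⟶ Z) (x : Space X) :
    toMap (f ≫ g) x = toMap g (toMap f x) := rfl

lemma congr_toMap {X Y : PtdTop.{u}} {f g : X ⟶ Y} (h : f = g) (x : Space X) :
    toMap f x = toMap g x := by rw [h]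

@[simp] lemma comp_const {X Y Z : PtdTop.{u}} (f : X ⟶ Y) : f ≫ const Y Z = const X Z :=
  hom_ext fun _ => rfl

@[simp] lemma const_comp {X Y Z : PtdTop.{u}} (f : Y ⟶ Z) : const X Y ≫ f = const X Z :=
  hom_ext fun _ => toMap_pt f

lemma eq_const_of_point {X : PtdTop.{u}} (f : point ⟶ X) : f = const point X :=
  hom_ext fun _ => toMap_pt f

/-! ### Embeddings as a class of maps with a left lifting property -/

/-- The two-element indiscrete space, pointed at either of its elements. -/
def indiscrete (a : Prop) : PtdTop.{u} :=
  @of (ULift.{u} Prop) ⊤ ⟨a⟩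

/-- The Sierpiński space, pointed at either of its elements. -/
def sierpinski (a : Prop) : PtdTop.{u} := of (ULift.{u} Prop) ⟨a⟩

/-- The maps to the point from the indiscrete and the Sierpiński space. The left lifting property
with respect to them characterizes topological embeddings. -/
inductive embeddingTests : MorphismProperty PtdTop.{u}
  | indiscrete (a : Prop) : embeddingTests (const (indiscrete a) point)
  | sierpinski (a : Prop) : embeddingTests (const (sierpinski a) point)

/-- The characteristic map of a subset, as a map to the indiscrete space. -/
def toIndiscrete {X : PtdTop.{u}} (S : Set (Space X)) : X ⟶ indiscrete.{u} (pt X ∈ S) :=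
  ofMap (Y := indiscrete.{u} (pt X ∈ S))
    (@ContinuousMap.mk _ _ _ (⊤ : TopologicalSpace (ULift.{u} Prop)) (fun x => ⟨x ∈ S⟩)
      continuous_top) rfl

lemma toIndiscrete_apply {X : PtdTop.{u}} (S : Set (Space X)) (x : Space X) :
    toMap (toIndiscrete S) x = (⟨x ∈ S⟩ : ULift.{u} Prop) := rfl

/-- The characteristic map of an open subset, as a map to the Sierpiński space. -/
def toSierpinski {X : PtdTop.{u}} (S : Set (Space X)) (hS : IsOpen S) :
    X ⟶ sierpinski.{u} (pt X ∈ S) :=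
  ofMap (Y := sierpinski.{u} (pt X ∈ S))
    ⟨fun x => (⟨x ∈ S⟩ : ULift.{u} Prop), continuous_uliftUp.comp (continuous_Prop.2 hS)⟩ rfl

lemma toSierpinski_apply {X : PtdTop.{u}} (S : Set (Space X)) (hS : IsOpen S) (x : Space X) :
    toMap (toSierpinski S hS) x = (⟨x ∈ S⟩ : ULift.{u} Prop) := rfl

lemma exists_lift_of_llp {X Y S : PtdTop.{u}} {i : X ⟶ Y} [HasLiftingProperty i (const S point)]
    (f : X ⟶ S) : ∃ g : Y ⟶ S, i ≫ g = f :=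
  have sq : CommSq f i (const S point) (const Y point) := ⟨by simp⟩
  ⟨sq.lift, sq.fac_left⟩

lemma hasLiftingProperty_const_point {X Y S : PtdTop.{u}} {i : X ⟶ Y}
    (h : ∀ f : X ⟶ S, ∃ g : Y ⟶ S, i ≫ g = f) : HasLiftingProperty i (const S point) where
  sq_hasLift {f _} _ := by
    obtain ⟨g, hg⟩ := h f
    exact ⟨⟨⟨g, hg, hom_ext fun _ => rfl⟩⟩⟩

lemma injective_of_llp {X Y : PtdTop.{u}} {i : X ⟶ Y} (hi : embeddingTests.llp i) :
    Function.Injective (toMap i) := by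
  intro x y hxy
  have := hi _ (.indiscrete (pt X ∈ ({x} : Set (Space X))))
  obtain ⟨g, hg⟩ := exists_lift_of_llp (i := i) (toIndiscrete {x})
  have h₁ := congr_toMap hg x
  have h₂ := congr_toMap hg y
  rw [comp_apply, toIndiscrete_apply] at h₁ h₂
  rw [← hxy, h₁] at h₂
  have h₃ : (x ∈ ({x} : Set (Space X))) = (y ∈ ({x} : Set (Space X))) := congrArg ULift.down h₂
  exact (h₃.mp rfl).symm

/-- Extending maps to indiscrete spaces separates points; extending maps to Sierpiński spaces makes
every open set of the source a preimage of an open set of the target. Both base points are needed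
because a characteristic map sends the base point to either value. -/
lemma isEmbedding_of_llp {X Y : PtdTop.{u}} {i : X ⟶ Y} (hi : embeddingTests.llp i) :
    Topology.IsEmbedding (toMap i) := by
  refine ⟨⟨le_antisymm (toMap i).continuous.le_induced ?_⟩, injective_of_llp hi⟩
  intro S hS
  have := hi _ (.sierpinski (pt X ∈ S))
  obtain ⟨g, hg⟩ := exists_lift_of_llp (i := i) (toSierpinski S hS)
  refine ⟨(fun y => (toMap g y : ULift.{u} Prop).down) ⁻¹' {True},
    IsOpen.preimage (continuous_uliftDown.comp (toMap g).continuous) isOpen_singleton_true, ?_⟩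
  ext x
  have h := congr_toMap hg x
  rw [comp_apply, toSierpinski_apply] at h
  have h' := congrArg ULift.down h
  simp only [Set.mem_preimage, Set.mem_singleton_iff, eq_iff_iff, iff_true]
  exact Eq.to_iff h'

lemma llp_of_isEmbedding {V Z : PtdTop.{u}} {i : V ⟶ Z} (hi : Topology.IsEmbedding (toMap i)) :
    embeddingTests.llp i := by
  intro _ _ _ h
  obtain a | a := h
  · refine hasLiftingProperty_const_point fun f => ?_
    let g : Space Z → ULift.{u} Prop := Function.extend (toMap i) (toMap f) fun _ => ⟨a⟩
    have hg : ∀ x, g (toMap i x) = toMap f x := fun x => hi.injective.extend_apply _ _ x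
    refine ⟨ofMap (Y := indiscrete.{u} a) (@ContinuousMap.mk _ _ _ (⊤ : TopologicalSpace
      (ULift.{u} Prop)) g continuous_top) ?_, hom_ext hg⟩
    change g (pt Z) = _
    rw [← toMap_pt i, hg, toMap_pt]
  · refine hasLiftingProperty_const_point fun f => ?_
    have hf : IsOpen ((fun y => (toMap f y : ULift.{u} Prop).down) ⁻¹' {True}) :=
      IsOpen.preimage (continuous_uliftDown.comp (toMap f).continuous) isOpen_singleton_true
    obtain ⟨U, hU, hUf⟩ := hi.isOpen_iff.1 hf
    have hg : ∀ x, (⟨toMap i x ∈ U⟩ : ULift.{u} Prop) = toMap f x := by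
      intro x
      apply ULift.down_injective
      have := congrArg (x ∈ ·) hUf
      simp only [Set.mem_preimage, Set.mem_singleton_iff, eq_iff_iff, iff_true] at this
      exact propext this
    refine ⟨ofMap (Y := sierpinski.{u} a) ⟨fun y => (⟨y ∈ U⟩ : ULift.{u} Prop),
      continuous_uliftUp.comp (continuous_Prop.2 hU)⟩ ?_, hom_ext hg⟩
    change (⟨pt Z ∈ U⟩ : ULift.{u} Prop) = _
    rw [← toMap_pt i, hg, toMap_pt]

/-! ### Smallness -/

/-- If every stage missed `y`, the characteristic map of `{y}` to the indiscrete space and the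
constant map would agree on all stages, yet differ at `y`. Nonemptiness of `K` ensures that the base
point is hit, so `y` is not the base point. -/
lemma exists_preimage_of_isColimit {K : Type u} [Category.{u} K] [Nonempty K] {F : K ⥤ PtdTop.{u}}
    {c : Cocone F} (hc : IsColimit c) (y : Space c.pt) :
    ∃ (k : K) (x : Space (F.obj k)), toMap (c.ι.app k) x = y := by
  by_contra! h
  let S : Set (Space c.pt) := {y}
  have hS : ∀ k x, toMap (c.ι.app k) x ∉ S := fun k x hx => h k x hx
  have hpt : pt c.pt ∉ S := by
    have h₀ : toMap (c.ι.app (Classical.arbitrary K)) (pt _) = pt c.pt := toMap_pt _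
    exact h₀ ▸ hS _ _
  have : toIndiscrete S = const _ _ := hc.hom_ext fun k => hom_ext fun x => by
    apply ULift.down_injective
    exact propext ⟨fun h' => (hS k x h').elim, fun h' => (hpt h').elim⟩
  have h₂ := congrArg ULift.down (congr_toMap this y)
  exact hpt (h₂.mp rfl)

lemma preservesColimit_coyoneda (W : PtdTop.{u}) (l : Cardinal.{u}) [Fact l.IsRegular]
    (hl : Cardinal.mk (Space W) < l) [OrderBot l.ord.ToType] {X Y : PtdTop.{u}} {f : X ⟶ Y}
    (c : embeddingTests.llp.TransfiniteCompositionOfShape l.ord.ToType f) :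
    PreservesColimit c.F (coyoneda.obj (Opposite.op W)) := by
  have hinj := fun j => isEmbedding_of_llp (c.mem_incl_app j)
  refine preservesColimit_of_preserves_colimit_cocone c.isColimit
    (Types.FilteredColimit.isColimitOf _ _ ?_ ?_)
  · intro (g : W ⟶ Y)
    choose k x hx using fun w => exists_preimage_of_isColimit c.isColimit (toMap g w)
    have hW : HasCardinalLT (Space W) l := by rwa [hasCardinalLT_iff_cardinal_mk_lt]
    -- There are fewer than `l` points and `l` is regular, so the stages chosen for the points have
    -- a common upper bound.
    let m := IsCardinalFiltered.max k hW
    let h : Space W → Space (c.F.obj m) := fun w =>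
      toMap (c.F.map (IsCardinalFiltered.toMax k hW w)) (x w)
    have hh : ∀ w, toMap (c.incl.app m) (h w) = toMap g w := by
      intro w
      rw [← hx w]
      exact congr_toMap (c.incl.naturality (IsCardinalFiltered.toMax k hW w)) (x w)
    -- The stage carries the topology induced from the colimit, so continuity of `g` passes to `h`.
    have hc : Continuous h := by
      rw [(hinj m).continuous_iff]
      exact (toMap g).continuous.congr fun w => (hh w).symm
    exact ⟨m, ofMap ⟨h, hc⟩ ((hinj m).injective (by
      change toMap (c.incl.app m) (h (pt W)) = _
      rw [hh, toMap_pt]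
      exact (toMap_pt (c.incl.app m)).symm)), hom_ext fun w => (hh w).symm⟩
  · intro i j (xi : W ⟶ _) (xj : W ⟶ _) (h : xi ≫ c.incl.app i = xj ≫ c.incl.app j)
    refine ⟨max i j, homOfLE (le_max_left _ _), homOfLE (le_max_right _ _), ?_⟩
    change xi ≫ c.F.map _ = xj ≫ c.F.map _
    apply hom_ext
    intro w
    apply (hinj (max i j)).injective
    have h₁ := congr_toMap (c.incl.naturality (homOfLE (le_max_left i j))) (toMap xi w)
    have h₂ := congr_toMap (c.incl.naturality (homOfLE (le_max_right i j))) (toMap xj w)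
    exact h₁.trans ((congr_toMap h w).trans h₂.symm)

lemma permitsSmallObjectArgument {I : MorphismProperty PtdTop.{u}} (hI : I ≤ embeddingTests.llp) :
    PermitsSmallObjectArgument.{u} I := by
  intro W _ _ _
  refine ⟨Order.succ (Cardinal.mk (Space W)), fun l hl hreg _ X Y f c => ?_⟩
  have : Fact l.IsRegular := ⟨hreg⟩
  -- Left lifting classes are stable under pushouts and transfinite compositions, hence contain the
  -- cell complexes as soon as they contain `I`.
  have hle : relativeCellComplexes.{u} I ≤ embeddingTests.llp :=
    ((MorphismProperty.transfiniteCompositions_monotone.{u}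
      (MorphismProperty.pushouts_le_llp_rlp I)).trans
        (MorphismProperty.transfiniteCompositions_le _)).trans
      (MorphismProperty.antitone_llp ((MorphismProperty.le_llp_iff_le_rlp _ _).1 hI))
  exact preservesColimit_coyoneda W l ((Order.lt_succ _).trans_le hl) (c.ofLE hle)

lemma hasSmallObjectArgument {I : MorphismProperty PtdTop.{u}} (hI : I ≤ embeddingTests.llp)
    [MorphismProperty.IsSmall.{u} I] : MorphismProperty.HasSmallObjectArgument.{u} I := by
  obtain ⟨ι, S, T, φ, rfl⟩ := (MorphismProperty.isSmall_iff_eq_ofHoms.{u} I).1 inferInstance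
  -- A successor of an infinite cardinal is regular, and the sum of all domains bounds each of them
  -- at once.
  let κ : Cardinal.{u} :=
    Order.succ (max Cardinal.aleph0 (Cardinal.mk (Σ k : ι, Space (S k))))
  have hreg : Fact κ.IsRegular := ⟨Cardinal.isRegular_succ (le_max_left _ _)⟩
  have : Nonempty κ.ord.ToType := by
    rw [Ordinal.nonempty_toType_iff]
    exact fun h => hreg.1.ne_zero (Cardinal.ord_eq_zero.1 h)
  let hbot : OrderBot κ.ord.ToType := WellFoundedLT.toOrderBot _
  refine ⟨κ, hreg, hbot, { preservesColimit := ?_ }⟩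
  rintro _ _ X Y _ ⟨k⟩ f hf
  refine preservesColimit_coyoneda _ κ ((Cardinal.mk_le_of_injective (f := fun x : Space (S k) =>
    (⟨k, x⟩ : Σ k : ι, Space (S k))) (fun x y h => by simpa using h)).trans_lt
      ((le_max_right _ _).trans_lt (Order.lt_succ _))) (f := f)
      { toTransfiniteCompositionOfShape := hf.toTransfiniteCompositionOfShape
        map_mem := fun j hj => ?_ }
  have h := (hf.attachCells j hj).pushouts_coproducts
  rw [MorphismProperty.ofHoms_homFamily] at h
  exact MorphismProperty.pushouts_le_iff.2 (MorphismProperty.coproducts_le_iff.2 hI) _ h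

end PtdTop

/-! ### The recognition of cofibrantly generated model structures -/

section Recognition

variable {C : Type u} [Category.{v} C]

/-- Retract argument: in a factorization of `f` by J.rlp.llp and J.rlp, the second factor is in `W`
by two-out-of-three, hence in I.rlp. Thus `f` lifts against it and is a retract of the first factor.
-/
lemma inf_eq_rlp_llp_of_rlp_eq {I J W : MorphismProperty C} [W.HasTwoOutOfThreeProperty]
    [J.rlp.llp.HasFactorization J.rlp] (h₁ : I.rlp = J.rlp ⊓ W) (h₂ : J.rlp.llp ≤ W) :
    I.rlp.llp ⊓ W = J.rlp.llp := by
  refine le_antisymm ?_ (le_inf (MorphismProperty.antitone_llp (h₁.trans_le inf_le_left)) h₂)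
  intro X Y f hf
  have fac := MorphismProperty.factorizationData J.rlp.llp J.rlp f
  have hp : I.rlp fac.p := by
    rw [h₁]
    exact ⟨fac.hp, W.of_precomp _ _ (h₂ _ fac.hi) (by rw [fac.fac]; exact hf.2)⟩
  have := hf.1 _ hp
  exact MorphismProperty.of_retract (RetractArrow.ofLeftLiftingProperty fac.fac) fac.hi

theorem exists_modelCategory [HasFiniteLimits C] [HasFiniteColimits C]
    {I J W : MorphismProperty C} [W.HasTwoOutOfThreeProperty]
    [MorphismProperty.HasFunctorialFactorization I.rlp.llp I.rlp]
    [MorphismProperty.HasFunctorialFactorization J.rlp.llp J.rlp]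
    (h₁ : I.rlp = J.rlp ⊓ W) (h₂ : J.rlp.llp ≤ W) :
    ∃ _ : ModelCategory C, fibrations C = J.rlp ∧ cofibrations C = I.rlp.llp ∧
      weakEquivalences C = W := by
  let cF : CategoryWithFibrations C := ⟨J.rlp⟩
  let cC : CategoryWithCofibrations C := ⟨I.rlp.llp⟩
  let cW : CategoryWithWeakEquivalences C := ⟨W⟩
  have hW : (weakEquivalences C).HasTwoOutOfThreeProperty :=
    inferInstanceAs W.HasTwoOutOfThreeProperty
  have hc : (trivialCofibrations C) = J.rlp.llp := inf_eq_rlp_llp_of_rlp_eq h₁ h₂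
  have hf : trivialFibrations C = I.rlp := h₁.symm
  have : (cofibrations C).IsWeakFactorizationSystem (trivialFibrations C) := by
    rw [hf]
    exact ⟨I.rlp_llp_rlp, rfl, inferInstanceAs (I.rlp.llp.HasFactorization I.rlp)⟩
  have : (trivialCofibrations C).IsWeakFactorizationSystem (fibrations C) := by
    rw [hc]
    exact ⟨J.rlp_llp_rlp, rfl, inferInstanceAs (J.rlp.llp.HasFactorization J.rlp)⟩
  exact ⟨ModelCategory.mk' C, rfl, rfl, rfl⟩

end Recognition

namespace PtdTop

/-! ### The generating sets and the classes of maps -/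

variable (A : PtdTop.{u})

instance isSmall_genCofibrations : MorphismProperty.IsSmall.{u} (genCofibrations A) where
  small_toSet := by
    let φ : Option (ℕ ⊕ ℕ) → (genCofibrations A).toSet
      | none => ⟨Arrow.mk (const point A), .point⟩
      | some (.inl n) => ⟨Arrow.mk (coneIncl (suspIter A n)), .cone n⟩
      | some (.inr n) => ⟨Arrow.mk (i₀ (cylIter A n)), .cyl n⟩
    have hφ : ∀ {X Y : PtdTop.{u}} (f : X ⟶ Y) (_ : genCofibrations A f),
        ∃ k, (φ k).1 = Arrow.mk f := by
      rintro _ _ _ (n | n | _)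
      exacts [⟨some (.inl n), rfl⟩, ⟨some (.inr n), rfl⟩, ⟨none, rfl⟩]
    exact small_of_surjective (f := φ) fun g => (hφ _ g.2).imp fun _ h => Subtype.ext h

instance isSmall_genTrivialCofibrations :
    MorphismProperty.IsSmall.{u} (genTrivialCofibrations A) where
  small_toSet := by
    let φ : ℕ ⊕ ℕ → (genTrivialCofibrations A).toSet
      | .inl n => ⟨Arrow.mk (i₀ (cylIter A n)), .cyl n⟩
      | .inr n => ⟨Arrow.mk (i₀ (cone (suspIter A n))), .cylCone n⟩
    have hφ : ∀ {X Y : PtdTop.{u}} (f : X ⟶ Y) (_ : genTrivialCofibrations A f),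
        ∃ k, (φ k).1 = Arrow.mk f := by
      rintro _ _ _ (n | n)
      exacts [⟨.inl n, rfl⟩, ⟨.inr n, rfl⟩]
    exact small_of_surjective (f := φ) fun g => (hφ _ g.2).imp fun _ h => Subtype.ext h

variable {A}

lemma hasHLP_iff {E B : PtdTop.{u}} {p : E ⟶ B} {X : PtdTop.{u}} :
    HasHLP p X ↔ HasLiftingProperty (i₀ X) p := by
  constructor
  · intro h
    exact ⟨fun {f g} sq => by
      obtain ⟨l, h₁, h₂⟩ := h f g sq.w.symm
      exact ⟨⟨l, h₁, h₂⟩⟩⟩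
  · intro _ f H w
    have sq : CommSq f (i₀ X) p H := ⟨w.symm⟩
    exact ⟨sq.lift, sq.fac_left, sq.fac_right⟩

lemma fibrationsA_eq_rlp : fibrationsA A = (genTrivialCofibrations A).rlp := by
  ext E B p
  constructor
  · rintro ⟨h₀, h₁, h₂⟩ _ _ _ (n | n)
    · cases n with
      | zero => exact hasHLP_iff.1 h₀
      | succ n => exact hasHLP_iff.1 (h₂ n)
    · exact hasHLP_iff.1 (h₁ n)
  · intro h
    exact ⟨hasHLP_iff.2 (h _ (.cyl 0)), fun n => hasHLP_iff.2 (h _ (.cylCone n)),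
      fun n => hasHLP_iff.2 (h _ (.cyl (n + 1)))⟩

lemma HomotopyClasses.map_comp (X : PtdTop.{u}) {Y Z T : PtdTop.{u}} (f : Y ⟶ Z) (g : Z ⟶ T) :
    HomotopyClasses.map X (f ≫ g) = HomotopyClasses.map X g ∘ HomotopyClasses.map X f := by
  ext ⟨a⟩
  rfl

instance hasTwoOutOfThree_weakEquivalencesA :
    (weakEquivalencesA A).HasTwoOutOfThreeProperty where
  comp_mem f g hf hg n := by
    rw [HomotopyClasses.map_comp]
    exact (hg n).comp (hf n)
  of_postcomp f g hg h n := by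
    have h := h n
    rw [HomotopyClasses.map_comp] at h
    exact ((hg n).of_comp_iff' _).1 h
  of_precomp f g hf h n := by
    have h := h n
    rw [HomotopyClasses.map_comp] at h
    exact (Function.Bijective.of_comp_iff _ (hf n)).1 h

/-! ### Maps out of cylinders, cones and suspensions -/

section Collapse

variable {X Y : PtdTop.{u}}

/-- The quotient of `X × I` by a subset, pointed at the class of `(∗, 0)`. -/
def collapseSpace (X : PtdTop.{u}) (S : Set (Space X × unitInterval)) : PtdTop.{u} :=
  of (Quotient (collapse S)) (Quotient.mk _ (pt X, 0))

/-- The class of a point of `X × I` in the quotient. -/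
def collapseMk (S : Set (Space X × unitInterval)) (z : Space X × unitInterval) :
    Space (collapseSpace X S) :=
  Quotient.mk (collapse S) z

@[fun_prop]
lemma continuous_collapseMk (S : Set (Space X × unitInterval)) : Continuous (collapseMk S) :=
  continuous_quotient_mk'

lemma collapseMk_of_mem {S : Set (Space X × unitInterval)} (h₀ : (pt X, 0) ∈ S)
    {z : Space X × unitInterval} (hz : z ∈ S) : collapseMk S z = pt (collapseSpace X S) :=
  Quotient.sound (Or.inr ⟨hz, h₀⟩)

lemma surjective_collapseMk (S : Set (Space X × unitInterval)) :
    Function.Surjective (collapseMk S) :=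
  Quotient.mk_surjective

lemma exists_collapse_desc {S : Set (Space X × unitInterval)} (h₀ : (pt X, 0) ∈ S)
    {f : Space X × unitInterval → Space Y} (hf : Continuous f) (hS : ∀ z ∈ S, f z = pt Y) :
    ∃ g : collapseSpace X S ⟶ Y, ∀ z, toMap g (collapseMk S z) = f z :=
  ⟨ofMap (X := collapseSpace X S) ⟨Quotient.lift f (by
      rintro a b (rfl | h)
      · rfl
      · rw [hS _ h.1, hS _ h.2]), hf.quotient_lift _⟩ (hS _ h₀), fun _ => rfl⟩

/-- The interval is locally compact, so the product of a quotient map with it is again a quotient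
map, whatever the space `X`. -/
lemma exists_collapse_prod_desc {S : Set (Space X × unitInterval)}
    {f : Space X × unitInterval × unitInterval → Space Y} (hf : Continuous f)
    (hS : ∀ z ∈ S, ∀ t, f (z.1, z.2, t) = pt Y) :
    ∃ g : Space (collapseSpace X S) × unitInterval → Space Y,
      Continuous g ∧ ∀ z t, g (collapseMk S z, t) = f (z.1, z.2, t) := by
  let g : Space (collapseSpace X S) × unitInterval → Space Y := fun q =>
    Quotient.lift (fun z : Space X × unitInterval => f (z.1, z.2, q.2)) (by
      rintro a b (rfl | h)
      · rfl
      · exact (hS _ h.1 _).trans (hS _ h.2 _).symm) q.1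
  have hq : Topology.IsQuotientMap (collapseMk S) := isQuotientMap_quotient_mk'
  refine ⟨g, hq.continuous_lift_prod_left ?_, fun _ _ => rfl⟩
  change Continuous fun p : (Space X × unitInterval) × unitInterval => f (p.1.1, p.1.2, p.2)
  fun_prop

lemma collapseSpace_hom_ext {S : Set (Space X × unitInterval)} {f g : collapseSpace X S ⟶ Y}
    (h : ∀ z, toMap f (collapseMk S z) = toMap g (collapseMk S z)) : f = g :=
  hom_ext fun q => by
    obtain ⟨z, rfl⟩ := surjective_collapseMk S q
    exact h z

end Collapse

/-! ### Lifting properties in terms of parametrized maps -/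

section Lift

variable {X E B : PtdTop.{u}} {p : E ⟶ B}

lemma exists_lift_cone (h : HasLiftingProperty (coneIncl X) p) {f : Space X → Space E}
    (hf : Continuous f) (f_pt : f (pt X) = pt E) {H : Space X × unitInterval → Space B}
    (hH : Continuous H) (H_zero : ∀ x, H (x, 0) = pt B) (H_pt : ∀ s, H (pt X, s) = pt B)
    (w : ∀ x, toMap p (f x) = H (x, 1)) :
    ∃ G : Space X × unitInterval → Space E, Continuous G ∧ (∀ x, G (x, 0) = pt E) ∧
      (∀ s, G (pt X, s) = pt E) ∧ (∀ x, G (x, 1) = f x) ∧ ∀ z, toMap p (G z) = H z := by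
  let S : Set (Space X × unitInterval) := {z | z.1 = pt X ∨ z.2 = 0}
  have h₀ : (pt X, 0) ∈ S := Or.inl rfl
  obtain ⟨b, hb⟩ := exists_collapse_desc (S := S) h₀ hH (by
    rintro ⟨x, s⟩ (hz | hz)
    · dsimp at hz; rw [hz, H_pt]
    · dsimp at hz; rw [hz, H_zero])
  have sq : CommSq (ofMap ⟨f, hf⟩ f_pt : X ⟶ E) (coneIncl X) p b :=
    ⟨hom_ext fun x => (w x).trans (hb (x, 1)).symm⟩
  obtain ⟨⟨l, hl₁, hl₂⟩⟩ := h.sq_hasLift sq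
  refine ⟨fun z => toMap l (collapseMk S z),
    (toMap l).continuous.comp (continuous_collapseMk S), fun x => ?_, fun s => ?_,
    fun x => congr_toMap hl₁ x, fun z => ?_⟩
  · exact (congrArg _ (collapseMk_of_mem h₀ (Or.inr rfl))).trans (toMap_pt l)
  · exact (congrArg _ (collapseMk_of_mem h₀ (Or.inl rfl))).trans (toMap_pt l)
  · exact (congr_toMap hl₂ (collapseMk S z)).trans (hb z)

/-- Here the middle coordinate is that of the suspension and the last one that of the cone. -/
lemma exists_lift_cone_susp (h : HasLiftingProperty (coneIncl (susp X)) p)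
    {f : Space X × unitInterval → Space E} (hf : Continuous f) (f_zero : ∀ x, f (x, 0) = pt E)
    (f_one : ∀ x, f (x, 1) = pt E) (f_pt : ∀ s, f (pt X, s) = pt E)
    {H : Space X × unitInterval × unitInterval → Space B} (hH : Continuous H)
    (H_left : ∀ x t, H (x, 0, t) = pt B) (H_right : ∀ x t, H (x, 1, t) = pt B)
    (H_bot : ∀ x s, H (x, s, 0) = pt B) (H_pt : ∀ s t, H (pt X, s, t) = pt B)
    (w : ∀ x s, toMap p (f (x, s)) = H (x, s, 1)) :
    ∃ G : Space X × unitInterval × unitInterval → Space E, Continuous G ∧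
      (∀ x t, G (x, 0, t) = pt E) ∧ (∀ x t, G (x, 1, t) = pt E) ∧ (∀ x s, G (x, s, 0) = pt E) ∧
      (∀ s t, G (pt X, s, t) = pt E) ∧ (∀ x s, G (x, s, 1) = f (x, s)) ∧
      ∀ z, toMap p (G z) = H z := by
  let S : Set (Space X × unitInterval) := {z | z.1 = pt X ∨ z.2 = 0 ∨ z.2 = 1}
  have h₀ : (pt X, 0) ∈ S := Or.inl rfl
  obtain ⟨f', hf'⟩ := exists_collapse_desc (S := S) h₀ hf (by
    rintro ⟨x, s⟩ (hz | hz | hz) <;> dsimp at hz <;> subst hz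
    exacts [f_pt _, f_zero _, f_one _])
  obtain ⟨H', hH', H'eq⟩ := exists_collapse_prod_desc (S := S) hH (by
    rintro ⟨x, s⟩ (hz | hz | hz) t <;> dsimp at hz <;> subst hz
    exacts [H_pt _ _, H_left _ _, H_right _ _])
  obtain ⟨G, hG, G_zero, G_pt, G_one, hpG⟩ := exists_lift_cone (X := susp X) h (toMap f').continuous
    (toMap_pt f') hH' (by
      intro q
      obtain ⟨z, rfl⟩ := surjective_collapseMk S q
      exact (H'eq _ _).trans (H_bot _ _)) (fun t => (H'eq (pt X, 0) t).trans (H_pt _ _)) (by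
      intro q
      obtain ⟨z, rfl⟩ := surjective_collapseMk S q
      exact (congrArg _ (hf' z)).trans ((w z.1 z.2).trans (H'eq z 1).symm))
  refine ⟨fun z => G (collapseMk S (z.1, z.2.1), z.2.2), by fun_prop, fun x t => ?_, fun x t => ?_,
    fun x s => G_zero _, fun s t => ?_, fun x s => (G_one _).trans (hf' _), fun z =>
      (hpG _).trans (H'eq _ _)⟩
  · exact (congrArg (fun q => G (q, t)) (collapseMk_of_mem h₀ (Or.inr (Or.inl rfl)))).trans (G_pt t)
  · exact (congrArg (fun q => G (q, t)) (collapseMk_of_mem h₀ (Or.inr (Or.inr rfl)))).trans (G_pt t)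
  · exact (congrArg (fun q => G (q, t)) (collapseMk_of_mem h₀ (Or.inl rfl))).trans (G_pt t)

lemma HasHLP.exists_lift (h : HasHLP p X) {f : Space X → Space E} (hf : Continuous f)
    (f_pt : f (pt X) = pt E) {H : Space X × unitInterval → Space B} (hH : Continuous H)
    (H_pt : ∀ s, H (pt X, s) = pt B) (w : ∀ x, toMap p (f x) = H (x, 0)) :
    ∃ G : Space X × unitInterval → Space E, Continuous G ∧ (∀ s, G (pt X, s) = pt E) ∧
      (∀ x, G (x, 0) = f x) ∧ ∀ z, toMap p (G z) = H z := by
  let S : Set (Space X × unitInterval) := {z | z.1 = pt X}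
  have h₀ : (pt X, 0) ∈ S := rfl
  obtain ⟨b, hb⟩ := exists_collapse_desc (S := S) h₀ hH (by
    rintro ⟨x, s⟩ hz
    obtain rfl : x = pt X := hz
    exact H_pt _)
  obtain ⟨l, hl₁, hl₂⟩ := h (ofMap ⟨f, hf⟩ f_pt) b
    (hom_ext fun x => (hb (x, 0)).trans (w x).symm)
  refine ⟨fun z => toMap l (collapseMk S z),
    (toMap l).continuous.comp (continuous_collapseMk S), fun s => ?_,
    fun x => congr_toMap hl₁ x, fun z => ?_⟩
  · exact (congrArg _ (collapseMk_of_mem h₀ rfl)).trans (toMap_pt l)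
  · exact (congr_toMap hl₂ (collapseMk S z)).trans (hb z)

lemma hasHLP_of_exists_lift (h : ∀ {f : Space X → Space E} (_ : Continuous f)
    (_ : f (pt X) = pt E) {H : Space X × unitInterval → Space B} (_ : Continuous H)
    (_ : ∀ s, H (pt X, s) = pt B) (_ : ∀ x, toMap p (f x) = H (x, 0)),
    ∃ G : Space X × unitInterval → Space E, Continuous G ∧ (∀ s, G (pt X, s) = pt E) ∧
      (∀ x, G (x, 0) = f x) ∧ ∀ z, toMap p (G z) = H z) : HasHLP p X := by
  intro f b w
  let S : Set (Space X × unitInterval) := {z | z.1 = pt X}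
  have h₀ : (pt X, 0) ∈ S := rfl
  obtain ⟨G, hG, G_pt, G_zero, hpG⟩ := h (toMap f).continuous (toMap_pt f)
    ((toMap b).continuous.comp (continuous_collapseMk S))
    (fun s => (congrArg _ (collapseMk_of_mem h₀ rfl)).trans (toMap_pt b))
    (fun x => (congr_toMap w x).symm)
  obtain ⟨l, hl⟩ := exists_collapse_desc (S := S) h₀ hG (by
    rintro ⟨x, s⟩ hz
    obtain rfl : x = pt X := hz
    exact G_pt _)
  exact ⟨l, hom_ext fun x => (hl (x, 0)).trans (G_zero x), collapseSpace_hom_ext (S := S) fun z =>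
    (congrArg _ (hl z)).trans (hpG z)⟩

lemma HasHLP.exists_lift_cone (h : HasHLP p (cone X)) {f : Space X × unitInterval → Space E}
    (hf : Continuous f) (f_zero : ∀ x, f (x, 0) = pt E) (f_pt : ∀ s, f (pt X, s) = pt E)
    {H : Space X × unitInterval × unitInterval → Space B} (hH : Continuous H)
    (H_left : ∀ x t, H (x, 0, t) = pt B) (H_pt : ∀ s t, H (pt X, s, t) = pt B)
    (w : ∀ x s, toMap p (f (x, s)) = H (x, s, 0)) :
    ∃ G : Space X × unitInterval × unitInterval → Space E, Continuous G ∧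
      (∀ x t, G (x, 0, t) = pt E) ∧ (∀ s t, G (pt X, s, t) = pt E) ∧
      (∀ x s, G (x, s, 0) = f (x, s)) ∧ ∀ z, toMap p (G z) = H z := by
  let S : Set (Space X × unitInterval) := {z | z.1 = pt X ∨ z.2 = 0}
  have h₀ : (pt X, 0) ∈ S := Or.inl rfl
  obtain ⟨f', hf'⟩ := exists_collapse_desc (S := S) h₀ hf (by
    rintro ⟨x, s⟩ (hz | hz) <;> dsimp at hz <;> subst hz
    exacts [f_pt _, f_zero _])
  obtain ⟨H', hH', H'eq⟩ := exists_collapse_prod_desc (S := S) hH (by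
    rintro ⟨x, s⟩ (hz | hz) t <;> dsimp at hz <;> subst hz
    exacts [H_pt _ _, H_left _ _])
  obtain ⟨G, hG, G_pt, G_zero, hpG⟩ := h.exists_lift (toMap f').continuous
    (toMap_pt f') hH' (fun t => (H'eq (pt X, 0) t).trans (H_pt _ _)) (by
      intro q
      obtain ⟨z, rfl⟩ := surjective_collapseMk S q
      exact (congrArg _ (hf' z)).trans ((w z.1 z.2).trans (H'eq z 0).symm))
  refine ⟨fun z => G (collapseMk S (z.1, z.2.1), z.2.2), by fun_prop, fun x t => ?_,
    fun s t => ?_, fun x s => (G_zero _).trans (hf' _), fun z => (hpG _).trans (H'eq _ _)⟩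
  · exact (congrArg (fun q => G (q, t)) (collapseMk_of_mem h₀ (Or.inr rfl))).trans (G_pt t)
  · exact (congrArg (fun q => G (q, t)) (collapseMk_of_mem h₀ (Or.inl rfl))).trans (G_pt t)

/-- The homotopy lifting property with respect to a quotient of `X × I` in terms of maps on
`X × I`. -/
lemma hasHLP_collapse_of_exists_lift {S : Set (Space X × unitInterval)} (h₀ : (pt X, 0) ∈ S)
    (h : ∀ {f : Space X × unitInterval → Space E} (_ : Continuous f) (_ : ∀ z ∈ S, f z = pt E)
      {H : Space X × unitInterval × unitInterval → Space B} (_ : Continuous H)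
      (_ : ∀ z ∈ S, ∀ t, H (z.1, z.2, t) = pt B) (_ : ∀ x s, toMap p (f (x, s)) = H (x, s, 0)),
      ∃ G : Space X × unitInterval × unitInterval → Space E, Continuous G ∧
        (∀ z ∈ S, ∀ t, G (z.1, z.2, t) = pt E) ∧ (∀ x s, G (x, s, 0) = f (x, s)) ∧
        ∀ z, toMap p (G z) = H z) : HasHLP p (collapseSpace X S) := by
  refine hasHLP_of_exists_lift fun {f} hf f_pt {H} hH H_pt w => ?_
  obtain ⟨G, hG, G_mem, G_zero, hpG⟩ := h (hf.comp (continuous_collapseMk S))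
    (fun z hz => (congrArg f (collapseMk_of_mem h₀ hz)).trans f_pt)
    (H := fun z => H (collapseMk S (z.1, z.2.1), z.2.2)) (by fun_prop)
    (fun z hz t => (congrArg (fun q => H (q, t)) (collapseMk_of_mem h₀ hz)).trans (H_pt t))
    (fun x s => w _)
  obtain ⟨G', hG', hG'G⟩ := exists_collapse_prod_desc (S := S) hG G_mem
  refine ⟨G', hG', fun t => (hG'G (pt X, 0) t).trans (G_mem _ h₀ t), fun q => ?_, ?_⟩
  · obtain ⟨z, rfl⟩ := surjective_collapseMk S q
    exact (hG'G _ _).trans (G_zero _ _)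
  · rintro ⟨q, t⟩
    obtain ⟨z, rfl⟩ := surjective_collapseMk S q
    exact (congrArg _ (hG'G _ _)).trans (hpG _)

end Lift

/-! ### Reparametrizations of the square -/

/-- The retraction of the real line onto the unit interval. -/
noncomputable def clamp (r : ℝ) : unitInterval := Set.projIcc 0 1 zero_le_one r

@[fun_prop]
lemma continuous_clamp : Continuous clamp := continuous_projIcc (h := zero_le_one)

lemma clamp_of_nonpos {r : ℝ} (h : r ≤ 0) : clamp r = 0 := Set.projIcc_of_le_left _ h

lemma clamp_of_one_le {r : ℝ} (h : 1 ≤ r) : clamp r = 1 := Set.projIcc_of_right_le _ h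

@[simp] lemma clamp_coe (s : unitInterval) : clamp s = s := Set.projIcc_val _ s

lemma coe_clamp {r : ℝ} (h₀ : 0 ≤ r) (h₁ : r ≤ 1) : (clamp r : ℝ) = r := by
  rw [clamp, Set.projIcc_of_mem _ ⟨h₀, h₁⟩]

/-- A continuous surjection from a compact to a Hausdorff space is proper, so its product with the
identity of any `X` is closed and therefore a quotient map. -/
lemma exists_descend {X K K' Y : Type*} [TopologicalSpace X] [TopologicalSpace K]
    [TopologicalSpace K'] [TopologicalSpace Y] [CompactSpace K] [T2Space K'] {q : K → K'}
    (hq : Continuous q) (hs : Function.Surjective q) {g : X × K → Y} (hg : Continuous g)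
    (hgq : ∀ x k k', q k = q k' → g (x, k) = g (x, k')) :
    ∃ g' : X × K' → Y, Continuous g' ∧ ∀ x k, g' (x, q k) = g (x, k) := by
  have hquot : Topology.IsQuotientMap (Prod.map (id : X → X) q) :=
    IsClosedMap.isQuotientMap (isProperMap_id.prodMap hq.isProperMap).isClosedMap
      (continuous_id.prodMap hq) (Function.surjective_id.prodMap hs)
  have heq : ∀ x k, g (x, Function.surjInv hs (q k)) = g (x, k) := fun x k =>
    hgq _ _ _ (Function.surjInv_eq hs _)
  refine ⟨fun z => g (z.1, Function.surjInv hs z.2), ?_, heq⟩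
  rw [hquot.continuous_iff]
  exact hg.congr fun z => (heq z.1 z.2).symm

/-- The horizontal coordinate of the path that runs along three sides of the rectangle
`[0, 1] × [-1, 1]`, from `(0, -1)` through `(1, -1)` and `(1, 1)` to `(0, 1)`. -/
def sidesFst (r : ℝ) : ℝ := min 1 (2 - |4 * r - 2|)

/-- The vertical coordinate of the path that runs along three sides of the rectangle
`[0, 1] × [-1, 1]`, from `(0, -1)` through `(1, -1)` and `(1, 1)` to `(0, 1)`. -/
def sidesSnd (r : ℝ) : ℝ := max (-1) (min 1 (4 * r - 2))

@[fun_prop]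
lemma continuous_sidesFst : Continuous sidesFst := by unfold sidesFst; fun_prop

@[fun_prop]
lemma continuous_sidesSnd : Continuous sidesSnd := by unfold sidesSnd; fun_prop

lemma sidesFst_nonneg (r : unitInterval) : 0 ≤ sidesFst r := by
  have h₀ := r.2.1
  have h₁ := r.2.2
  unfold sidesFst
  grind [abs_eq_max_neg]

lemma sidesFst_le_one (r : ℝ) : sidesFst r ≤ 1 := min_le_left _ _

lemma abs_sidesSnd_le_one (r : ℝ) : |sidesSnd r| ≤ 1 :=
  abs_le.2 ⟨le_max_left _ _, max_le (by norm_num) (min_le_left _ _)⟩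

lemma sidesFst_of_le {r : ℝ} (h : 4 * r ≤ 1) : sidesFst r = 4 * r := by
  rw [sidesFst, abs_of_nonpos (by linarith), min_eq_right (by linarith)]
  ring

lemma sidesFst_of_mem {r : ℝ} (h : 1 ≤ 4 * r) (h' : 4 * r ≤ 3) : sidesFst r = 1 :=
  have : |4 * r - 2| ≤ 1 := abs_le.2 ⟨by linarith, by linarith⟩
  min_eq_left (by linarith)

lemma sidesFst_of_ge {r : ℝ} (h : 3 ≤ 4 * r) : sidesFst r = 4 - 4 * r := by
  rw [sidesFst, abs_of_nonneg (by linarith), min_eq_right (by linarith)]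
  ring

lemma sidesSnd_of_le {r : ℝ} (h : 4 * r ≤ 1) : sidesSnd r = -1 := by
  rw [sidesSnd, min_eq_right (by linarith), max_eq_left (by linarith)]

lemma sidesSnd_of_mem {r : ℝ} (h : 1 ≤ 4 * r) (h' : 4 * r ≤ 3) : sidesSnd r = 4 * r - 2 := by
  rw [sidesSnd, min_eq_right (by linarith), max_eq_right (by linarith)]

lemma sidesSnd_of_ge {r : ℝ} (h : 3 ≤ 4 * r) : sidesSnd r = 1 := by
  rw [sidesSnd, min_eq_left (by linarith), max_eq_right (by norm_num)]

lemma max_sides_eq_one (r : unitInterval) : max (sidesFst r) |sidesSnd r| = 1 := by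
  obtain h | h := le_total (4 * (r : ℝ)) 1
  · rw [sidesSnd_of_le h, abs_neg, abs_one]
    exact max_eq_right (sidesFst_le_one _)
  obtain h' | h' := le_total (4 * (r : ℝ)) 3
  · rw [sidesFst_of_mem h h']
    exact max_eq_left (abs_sidesSnd_le_one _)
  · rw [sidesSnd_of_ge h', abs_one]
    exact max_eq_right (sidesFst_le_one _)

lemma sides_injective {r r' : ℝ} (h₁ : sidesFst r = sidesFst r') (h₂ : sidesSnd r = sidesSnd r') :
    r = r' := by
  obtain h | h := le_total (4 * r) 1
  · rw [sidesFst_of_le h, sidesSnd_of_le h] at *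
    obtain h' | h' := le_total (4 * r') 1
    · rw [sidesFst_of_le h'] at h₁
      linarith
    obtain k | k := le_total (4 * r') 3
    · rw [sidesFst_of_mem h' k] at h₁
      rw [sidesSnd_of_mem h' k] at h₂
      linarith
    · rw [sidesSnd_of_ge k] at h₂
      linarith
  obtain k | k := le_total (4 * r) 3
  · rw [sidesFst_of_mem h k, sidesSnd_of_mem h k] at *
    obtain h' | h' := le_total (4 * r') 1
    · rw [sidesFst_of_le h'] at h₁
      rw [sidesSnd_of_le h'] at h₂
      linarith
    obtain k' | k' := le_total (4 * r') 3
    · rw [sidesSnd_of_mem h' k'] at h₂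
      linarith
    · rw [sidesFst_of_ge k'] at h₁
      rw [sidesSnd_of_ge k'] at h₂
      linarith
  · rw [sidesFst_of_ge k, sidesSnd_of_ge k] at *
    obtain h' | h' := le_total (4 * r') 1
    · rw [sidesSnd_of_le h'] at h₂
      linarith
    obtain k' | k' := le_total (4 * r') 3
    · rw [sidesFst_of_mem h' k'] at h₁
      rw [sidesSnd_of_mem h' k'] at h₂
      linarith
    · rw [sidesFst_of_ge k'] at h₁
      linarith

lemma exists_sides_eq {a b : ℝ} (ha : 0 ≤ a) (h : max a |b| = 1) :
    ∃ r : unitInterval, sidesFst r = a ∧ sidesSnd r = b := by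
  have ha' : a ≤ 1 := (le_max_left _ _).trans h.le
  have hb := abs_le.1 ((le_max_right _ _).trans h.le)
  obtain h₁ | h₁ := eq_or_ne b 1
  · refine ⟨⟨(4 - a) / 4, by linarith, by linarith⟩, ?_, ?_⟩
    · rw [sidesFst_of_ge (by dsimp only; linarith)]
      dsimp only
      ring
    · rw [sidesSnd_of_ge (by dsimp only; linarith), h₁]
  obtain h₂ | h₂ := eq_or_ne b (-1)
  · refine ⟨⟨a / 4, by linarith, by linarith⟩, ?_, ?_⟩
    · rw [sidesFst_of_le (by dsimp only; linarith)]
      dsimp only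
      ring
    · rw [sidesSnd_of_le (by dsimp only; linarith), h₂]
  · have hb' : |b| < 1 := abs_lt.2 ⟨lt_of_le_of_ne hb.1 h₂.symm, lt_of_le_of_ne hb.2 h₁⟩
    have ha₁ : a = 1 := (max_eq_iff.1 h).elim (fun h => h.1) fun h => absurd h.1 hb'.ne
    refine ⟨⟨(b + 2) / 4, by linarith, by linarith⟩, ?_, ?_⟩
    · rw [sidesFst_of_mem (by dsimp only; linarith) (by dsimp only; linarith), ha₁]
    · rw [sidesSnd_of_mem (by dsimp only; linarith) (by dsimp only; linarith)]
      dsimp only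
      ring

/-- The map from the square onto itself that sends the segment `{r} × I` linearly to the segment
from the midpoint of the left side to a point of the union of the three other sides. -/
noncomputable def fan (z : unitInterval × unitInterval) : unitInterval × unitInterval :=
  (clamp (z.2 * sidesFst z.1), clamp ((1 + z.2 * sidesSnd z.1) / 2))

@[fun_prop]
lemma continuous_fan : Continuous fan := by unfold fan; fun_prop

lemma coe_fan_fst (z : unitInterval × unitInterval) :
    ((fan z).1 : ℝ) = z.2 * sidesFst z.1 :=
  coe_clamp (mul_nonneg z.2.2.1 (sidesFst_nonneg _))
    (mul_le_one₀ z.2.2.2 (sidesFst_nonneg _) (sidesFst_le_one _))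

lemma coe_fan_snd (z : unitInterval × unitInterval) :
    ((fan z).2 : ℝ) = (1 + z.2 * sidesSnd z.1) / 2 := by
  have h₁ := abs_le.1 (abs_sidesSnd_le_one z.1)
  have h₂ := z.2.2.1
  have h₃ := z.2.2.2
  exact coe_clamp (by nlinarith) (by nlinarith)

lemma fan_fst_eq_zero {z : unitInterval × unitInterval} (h : z.1 = 0 ∨ z.1 = 1 ∨ z.2 = 0) :
    (fan z).1 = 0 := by
  apply Subtype.ext
  rw [coe_fan_fst]
  obtain h | h | h := h <;> rw [h] <;> norm_num [sidesFst]

/-- The gauge max(s, |2t − 1|) equals 1 exactly on the three sides and recovers the radial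
coordinate of `fan`. -/
lemma max_fan (z : unitInterval × unitInterval) :
    max ((fan z).1 : ℝ) |2 * ((fan z).2 : ℝ) - 1| = z.2 := by
  rw [coe_fan_fst, coe_fan_snd]
  have : 2 * ((1 + (z.2 : ℝ) * sidesSnd z.1) / 2) - 1 = z.2 * sidesSnd z.1 := by ring
  rw [this, abs_mul, abs_of_nonneg z.2.2.1, ← mul_max_of_nonneg _ _ z.2.2.1, max_sides_eq_one,
    mul_one]

lemma surjective_fan : Function.Surjective fan := by
  rintro ⟨s, t⟩
  have hs := s.2.1
  have hs' := s.2.2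
  have ht := t.2.1
  have ht' := t.2.2
  set m : ℝ := max (s : ℝ) |2 * (t : ℝ) - 1| with hm
  have hm₀ : 0 ≤ m := hs.trans (le_max_left _ _)
  have hm₁ : m ≤ 1 := max_le hs' (abs_le.2 ⟨by linarith, by linarith⟩)
  obtain h | h := hm₀.eq_or_lt
  · refine ⟨(0, 0), Prod.ext (Subtype.ext ?_) (Subtype.ext ?_)⟩
    · rw [coe_fan_fst]
      simp only [Set.Icc.coe_zero, zero_mul]
      linarith [le_max_left (s : ℝ) |2 * (t : ℝ) - 1|]
    · rw [coe_fan_snd]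
      simp only [Set.Icc.coe_zero, zero_mul]
      linarith [abs_le.1 ((le_max_right (s : ℝ) |2 * (t : ℝ) - 1|).trans h.symm.le)]
  · obtain ⟨r, hr₁, hr₂⟩ := exists_sides_eq (a := s / m) (b := (2 * t - 1) / m) (by positivity) (by
      rw [abs_div, abs_of_pos h, max_div_div_right h.le, ← hm, div_self h.ne'])
    refine ⟨(r, ⟨m, hm₀, hm₁⟩), Prod.ext (Subtype.ext ?_) (Subtype.ext ?_)⟩
    · rw [coe_fan_fst, hr₁]
      exact mul_div_cancel₀ _ h.ne'
    · rw [coe_fan_snd, hr₂]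
      change (1 + m * ((2 * t - 1) / m)) / 2 = _
      rw [mul_div_cancel₀ _ h.ne']
      ring

lemma fan_fiber {z z' : unitInterval × unitInterval} (h : fan z = fan z') :
    z = z' ∨ (z.2 = 0 ∧ z'.2 = 0) := by
  have h₂ : z.2 = z'.2 := Subtype.ext (by rw [← max_fan z, ← max_fan z', h])
  by_cases h₀ : z.2 = 0
  · exact Or.inr ⟨h₀, h₂ ▸ h₀⟩
  have h₀' : (z.2 : ℝ) ≠ 0 := fun h => h₀ (Subtype.ext h)
  have e₁ := congrArg (fun y => (y.1 : ℝ)) h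
  have e₂ := congrArg (fun y => (y.2 : ℝ)) h
  simp only [coe_fan_fst, coe_fan_snd, ← h₂] at e₁ e₂
  refine Or.inl (Prod.ext (Subtype.ext (sides_injective (mul_left_cancel₀ h₀' e₁)
    (mul_left_cancel₀ h₀' ?_))) h₂)
  linarith

/-! ### Filling squares and lifting homotopies relative to the base of a cone -/

section Lift

variable {X E B : PtdTop.{u}} {p : E ⟶ B}

/-- If `p` has the right lifting property with respect to `ΣX → CΣX`, then lifts of maps on
`X × I × I` that are trivial on the left side of the square can be prescribed on the union of the
other three sides. -/
lemma exists_lift_square (h : HasLiftingProperty (coneIncl (susp X)) p)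
    {F : Space X × unitInterval → Space E} (hF : Continuous F) (F_zero : ∀ x, F (x, 0) = pt E)
    (F_one : ∀ x, F (x, 1) = pt E) (F_pt : ∀ s, F (pt X, s) = pt E)
    {H : Space X × unitInterval × unitInterval → Space B} (hH : Continuous H)
    (H_left : ∀ x t, H (x, 0, t) = pt B) (H_pt : ∀ s t, H (pt X, s, t) = pt B)
    (w : ∀ x r, toMap p (F (x, r)) = H (x, fan (r, 1))) :
    ∃ G : Space X × unitInterval × unitInterval → Space E, Continuous G ∧
      (∀ x t, G (x, 0, t) = pt E) ∧ (∀ s t, G (pt X, s, t) = pt E) ∧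
      (∀ x r, G (x, fan (r, 1)) = F (x, r)) ∧ ∀ z, toMap p (G z) = H z := by
  -- Under `fan` the left side pulls back to the two vertical sides and the bottom edge, where maps
  -- out of the cone on a suspension are trivial. The other three sides become the top edge, the
  -- base of that cone.
  have hleft : ∀ x z, (z.1 = 0 ∨ z.1 = 1 ∨ z.2 = 0) → H (x, fan z) = pt B := fun x z hz => by
    rw [← Prod.mk.eta (p := fan z), fan_fst_eq_zero hz, H_left]
  obtain ⟨G', hG', G'_left, G'_right, G'_bot, G'_pt, G'_top, hpG'⟩ := exists_lift_cone_susp h hF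
    F_zero F_one F_pt (H := fun z => H (z.1, fan (z.2.1, z.2.2))) (by fun_prop)
    (fun x t => hleft _ _ (Or.inl rfl)) (fun x t => hleft _ _ (Or.inr (Or.inl rfl)))
    (fun x s => hleft _ _ (Or.inr (Or.inr rfl))) (fun s t => H_pt _ _) w
  obtain ⟨G, hG, hGG'⟩ := exists_descend continuous_fan surjective_fan hG' (by
    intro x z z' hz
    obtain rfl | ⟨h₁, h₂⟩ := fan_fiber hz
    · rfl
    · rw [← Prod.mk.eta (p := z), ← Prod.mk.eta (p := z'), h₁, h₂, G'_bot, G'_bot])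
  refine ⟨G, hG, fun x t => ?_, fun s t => ?_, fun x r => (hGG' _ _).trans (G'_top _ _), ?_⟩
  · obtain ⟨⟨r, m⟩, hz⟩ := surjective_fan (0, t)
    rw [← hz, hGG']
    have h₀ : (m : ℝ) * sidesFst r = 0 := by
      rw [← coe_fan_fst (r, m), hz, Set.Icc.coe_zero]
    obtain h₀ | h₀ := mul_eq_zero.1 h₀
    · obtain rfl : m = 0 := Subtype.ext h₀
      exact G'_bot _ _
    · have hr₀ := r.2.1
      have hr₁ := r.2.2
      have hr : r = 0 ∨ r = 1 := by
        rw [Subtype.ext_iff, Subtype.ext_iff, Set.Icc.coe_zero, Set.Icc.coe_one]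
        obtain h | h := le_total (4 * (r : ℝ)) 1
        · rw [sidesFst_of_le h] at h₀
          exact Or.inl (by linarith)
        obtain h' | h' := le_total (4 * (r : ℝ)) 3
        · rw [sidesFst_of_mem h h'] at h₀
          linarith
        · rw [sidesFst_of_ge h'] at h₀
          exact Or.inr (by linarith)
      obtain rfl | rfl := hr
      · exact G'_left _ _
      · exact G'_right _ _
  · obtain ⟨z, hz⟩ := surjective_fan (s, t)
    rw [← hz, hGG']
    exact G'_pt _ _
  · rintro ⟨x, y⟩
    obtain ⟨z, rfl⟩ := surjective_fan y
    rw [hGG', hpG']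

/-- If `p` has the homotopy lifting property with respect to `CX`, then homotopies on `CX` that
are constant on `X` have lifts that are constant on `X`. -/
lemma HasHLP.exists_lift_cone_rel (h : HasHLP p (cone X)) {f : Space X × unitInterval → Space E}
    (hf : Continuous f) (f_zero : ∀ x, f (x, 0) = pt E) (f_pt : ∀ s, f (pt X, s) = pt E)
    {H : Space X × unitInterval × unitInterval → Space B} (hH : Continuous H)
    (H_left : ∀ x t, H (x, 0, t) = pt B) (H_right : ∀ x t, H (x, 1, t) = H (x, 1, 0))
    (H_pt : ∀ s t, H (pt X, s, t) = pt B) (w : ∀ x s, toMap p (f (x, s)) = H (x, s, 0)) :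
    ∃ G : Space X × unitInterval × unitInterval → Space E, Continuous G ∧
      (∀ x t, G (x, 0, t) = pt E) ∧ (∀ x t, G (x, 1, t) = f (x, 1)) ∧
      (∀ s t, G (pt X, s, t) = pt E) ∧ (∀ x s, G (x, s, 0) = f (x, s)) ∧
      ∀ z, toMap p (G z) = H z := by
  -- The map `q` collapses the edge s = 1 of the square and has a triangle as image. Since `H` is
  -- constant along that edge, it descends to the triangle; the retraction `r` extends it back to
  -- the square. A lift of this extension, precomposed with `q`, is constant along s = 1.
  let T := {z : unitInterval × unitInterval // z.2 ≤ unitInterval.symm z.1}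
  let q : unitInterval × unitInterval → T := fun z =>
    ⟨(z.1, unitInterval.symm z.1 * z.2), unitInterval.mul_le_left⟩
  let r : unitInterval × unitInterval → T := fun z =>
    ⟨(z.1, min z.2 (unitInterval.symm z.1)), min_le_right _ _⟩
  have hr : Continuous r := by fun_prop
  have hrq : ∀ s t, r (s, unitInterval.symm s * t) = q (s, t) := fun s t =>
    Subtype.ext (Prod.ext rfl (min_eq_left unitInterval.mul_le_left))
  have hs : Function.Surjective q := by
    rintro ⟨⟨s, t⟩, ht⟩
    obtain ⟨v, hv⟩ : ∃ v : unitInterval, unitInterval.symm s * v = t := by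
      have ht' : (t : ℝ) ≤ 1 - s := ht
      obtain h₁ | h₁ := s.2.2.eq_or_lt
      · exact ⟨0, Subtype.ext (by simp; linarith [t.2.1])⟩
      · have : 0 < 1 - (s : ℝ) := by linarith
        exact ⟨⟨t / (1 - s), div_nonneg t.2.1 this.le, (div_le_one this).2 ht'⟩,
          Subtype.ext (mul_div_cancel₀ _ this.ne')⟩
    exact ⟨(s, v), Subtype.ext (Prod.ext rfl hv)⟩
  obtain ⟨H', hH', H'eq⟩ := exists_descend (q := q) (by fun_prop) hs hH (by
    rintro x ⟨s, t⟩ ⟨s', t'⟩ hz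
    have hz := congrArg Subtype.val hz
    obtain rfl : s = s' := congrArg Prod.fst hz
    have hz : unitInterval.symm s * t = unitInterval.symm s * t' := congrArg Prod.snd hz
    obtain rfl | h₁ := eq_or_ne s 1
    · rw [H_right, H_right x t']
    · have h₁ : (unitInterval.symm s : ℝ) ≠ 0 := fun h₀ => h₁ (by
        rwa [← unitInterval.symm_eq_zero, Subtype.ext_iff])
      rw [Subtype.ext (mul_left_cancel₀ h₁ (congrArg Subtype.val hz))])
  obtain ⟨G, hG, G_left, G_pt, G_bot, hpG⟩ := h.exists_lift_cone hf f_zero f_pt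
    (H := fun z => H' (z.1, r z.2)) (by fun_prop)
    (fun x t => by
      have := hrq 0 t
      rw [unitInterval.symm_zero, one_mul] at this
      exact (congrArg (fun y => H' (x, y)) this).trans ((H'eq _ _).trans (H_left _ _)))
    (fun s t => by
      obtain ⟨z, hz⟩ := hs (r (s, t))
      exact (congrArg (fun y => H' (pt X, y)) hz.symm).trans ((H'eq _ _).trans (H_pt _ _)))
    (fun x s => by
      have := hrq s 0
      rw [mul_zero] at this
      exact (w x s).trans ((H'eq _ _).symm.trans (congrArg (fun y => H' (x, y)) this.symm)))
  refine ⟨fun z => G (z.1, z.2.1, unitInterval.symm z.2.1 * z.2.2), by fun_prop,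
    fun x t => G_left _ _, fun x t => ?_, fun s t => G_pt _ _, fun x s => ?_, fun z => ?_⟩
  · simp only [unitInterval.symm_one, zero_mul, G_bot]
  · simp only [mul_zero, G_bot]
  · rw [hpG]
    exact (congrArg (fun y => H' (z.1, y)) (hrq _ _)).trans (H'eq _ _)

/-- The homotopy lifting property with respect to `CX` implies that with respect to `ΣX`. -/
lemma HasHLP.susp (h : HasHLP p (cone X)) : HasHLP p (susp X) := by
  refine hasHLP_collapse_of_exists_lift (Or.inl rfl) fun {f} hf f_S {H} hH H_S w => ?_
  obtain ⟨G, hG, G_left, G_right, G_pt, G_bot, hpG⟩ := h.exists_lift_cone_rel hf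
    (fun x => f_S (x, 0) (Or.inr (Or.inl rfl))) (fun s => f_S (pt X, s) (Or.inl rfl)) hH
    (fun x t => H_S (x, 0) (Or.inr (Or.inl rfl)) t)
    (fun x t => (H_S (x, 1) (Or.inr (Or.inr rfl)) t).trans
      (H_S (x, 1) (Or.inr (Or.inr rfl)) 0).symm) (fun s t => H_S (pt X, s) (Or.inl rfl) t) w
  refine ⟨G, hG, ?_, G_bot, hpG⟩
  rintro ⟨x, s⟩ (hz | hz | hz) t <;> dsimp at hz <;> subst hz
  exacts [G_pt _ _, G_left _ _, (G_right _ _).trans (f_S (x, 1) (Or.inr (Or.inr rfl)))]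

end Lift

/-! ### Pointed homotopies as parametrized maps -/

section Homotopy

variable {X Y : PtdTop.{u}}

lemma homotopic_iff {f g : X ⟶ Y} : Homotopic f g ↔
    ∃ K : Space X × unitInterval → Space Y, Continuous K ∧ (∀ s, K (pt X, s) = pt Y) ∧
      (∀ x, K (x, 0) = toMap f x) ∧ ∀ x, K (x, 1) = toMap g x := by
  constructor
  · rintro ⟨K⟩
    exact ⟨fun z => K (z.2, z.1), by fun_prop,
      fun s => (K.eq_fst s (Set.mem_singleton _)).trans (toMap_pt f),
      fun x => K.apply_zero x, fun x => K.apply_one x⟩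
  · rintro ⟨K, hK, K_pt, K_zero, K_one⟩
    exact ⟨{
      toFun := fun z => K (z.2, z.1)
      map_zero_left := K_zero
      map_one_left := K_one
      prop' := by
        rintro t x rfl
        exact (K_pt t).trans (toMap_pt f).symm }⟩

lemma homotopic_const_iff {f : X ⟶ Y} : Homotopic f (const X Y) ↔
    ∃ K : Space X × unitInterval → Space Y, Continuous K ∧ (∀ x, K (x, 0) = pt Y) ∧
      (∀ s, K (pt X, s) = pt Y) ∧ ∀ x, K (x, 1) = toMap f x := by
  constructor
  · intro h
    obtain ⟨K, hK, K_pt, K_zero, K_one⟩ := homotopic_iff.1 ((homotopySetoid X Y).symm h)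
    exact ⟨K, hK, K_zero, K_pt, K_one⟩
  · rintro ⟨K, hK, K_zero, K_pt, K_one⟩
    exact (homotopySetoid X Y).symm (homotopic_iff.2 ⟨K, hK, K_pt, K_zero, K_one⟩)

lemma Homotopic.comp_right {Z : PtdTop.{u}} {f g : X ⟶ Y} (h : Homotopic f g) (k : Y ⟶ Z) :
    Homotopic (f ≫ k) (g ≫ k) :=
  ContinuousMap.HomotopicRel.comp_continuousMap h (toMap k)

end Homotopy

/-! ### Consequences of lifting against inclusions of bases of cones -/

section Lift

variable {X E B : PtdTop.{u}} {p : E ⟶ B}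

lemma fan_one_of_le {r : unitInterval} (h : 4 * (r : ℝ) ≤ 1) : fan (r, 1) = (clamp (4 * r), 0) := by
  unfold fan
  rw [sidesFst_of_le h, sidesSnd_of_le h]
  refine Prod.ext ?_ ?_
  · simp
  · exact clamp_of_nonpos (by simp)

lemma fan_one_of_mem {r : unitInterval} (h : 1 ≤ 4 * (r : ℝ)) (h' : 4 * (r : ℝ) ≤ 3) :
    fan (r, 1) = (1, clamp ((4 * r - 1) / 2)) := by
  unfold fan
  rw [sidesFst_of_mem h h', sidesSnd_of_mem h h']
  refine Prod.ext ?_ ?_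
  · exact clamp_of_one_le (by simp)
  · simp only [Set.Icc.coe_one]
    ring_nf

lemma fan_one_of_ge {r : unitInterval} (h : 3 ≤ 4 * (r : ℝ)) :
    fan (r, 1) = (clamp (4 - 4 * r), 1) := by
  unfold fan
  rw [sidesFst_of_ge h, sidesSnd_of_ge h]
  refine Prod.ext ?_ ?_
  · simp
  · exact clamp_of_one_le (by norm_num)

lemma coe_clamp_div (s : unitInterval) : (clamp (s / 4 : ℝ) : ℝ) = s / 4 :=
  coe_clamp (by linarith [s.2.1]) (by linarith [s.2.2])

lemma fan_bot (s : unitInterval) : fan (clamp (s / 4), 1) = (s, 0) := by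
  rw [fan_one_of_le (by rw [coe_clamp_div]; linarith [s.2.2]), coe_clamp_div,
    mul_div_cancel₀ _ four_ne_zero, clamp_coe]

lemma coe_clamp_one_sub_div (s : unitInterval) : (clamp (1 - s / 4 : ℝ) : ℝ) = 1 - s / 4 :=
  coe_clamp (by linarith [s.2.2]) (by linarith [s.2.1])

lemma fan_top (s : unitInterval) : fan (clamp (1 - s / 4), 1) = (s, 1) := by
  rw [fan_one_of_ge (by rw [coe_clamp_one_sub_div]; linarith [s.2.2]), coe_clamp_one_sub_div,
    show 4 - 4 * (1 - (s : ℝ) / 4) = s by ring, clamp_coe]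

lemma coe_clamp_right (t : unitInterval) : (clamp ((2 * t + 1) / 4 : ℝ) : ℝ) = (2 * t + 1) / 4 :=
  coe_clamp (by linarith [t.2.1]) (by linarith [t.2.2])

lemma fan_right (t : unitInterval) : fan (clamp ((2 * t + 1) / 4), 1) = (1, t) := by
  rw [fan_one_of_mem (by rw [coe_clamp_right]; linarith [t.2.1])
    (by rw [coe_clamp_right]; linarith [t.2.2]), coe_clamp_right,
    show (4 * ((2 * (t : ℝ) + 1) / 4) - 1) / 2 = t by ring, clamp_coe]

/-- The lift is given on the bottom side only. Lifting against X → CX extends it over the right and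
top sides, and then the square can be filled. -/
lemma hasHLP_cone (h : HasLiftingProperty (coneIncl X) p)
    (h' : HasLiftingProperty (coneIncl (susp X)) p) : HasHLP p (cone X) := by
  refine hasHLP_collapse_of_exists_lift (Or.inl rfl) fun {f} hf f_S {H} hH H_S w => ?_
  have f_zero : ∀ x, f (x, 0) = pt E := fun x => f_S (x, 0) (Or.inr rfl)
  have f_pt : ∀ s, f (pt X, s) = pt E := fun s => f_S (pt X, s) (Or.inl rfl)
  have H_left : ∀ x t, H (x, 0, t) = pt B := fun x t => H_S (x, 0) (Or.inr rfl) t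
  have H_pt : ∀ s t, H (pt X, s, t) = pt B := fun s t => H_S (pt X, s) (Or.inl rfl) t
  -- The parameter 1 − 3/4 · s runs from 1, the corner (0, 1), to 1/4, the corner (1, 0), so the
  -- cone is parametrized backwards along the top and down the right side.
  obtain ⟨g, hg, g_zero, g_pt, g_one, hpg⟩ := exists_lift_cone h (f := fun x => f (x, 1))
    (by fun_prop) (f_pt 1) (H := fun z => H (z.1, fan (clamp (1 - 3 / 4 * z.2), 1)))
    (by fun_prop) (fun x => by
      have : clamp (1 - 3 / 4 * ((0 : unitInterval) : ℝ)) = 1 := clamp_of_one_le (by simp)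
      rw [this, ← Prod.mk.eta (p := fan (1, 1)), fan_fst_eq_zero (Or.inr (Or.inl rfl)), H_left])
    (fun s => H_pt _ _) (fun x => by
      have : (1 - 3 / 4 * ((1 : unitInterval) : ℝ)) = ((1 : unitInterval) : ℝ) / 4 := by
        norm_num
      rw [this, fan_bot, w])
  let F : Space X × unitInterval → Space E := fun z =>
    if (z.2 : ℝ) ≤ 1 / 4 then f (z.1, clamp (4 * z.2)) else g (z.1, clamp (4 / 3 * (1 - z.2)))
  have hF : Continuous F := by
    refine Continuous.if_le (by fun_prop) (by fun_prop) (by fun_prop) (by fun_prop) ?_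
    rintro ⟨x, r⟩ hr
    dsimp only at hr ⊢
    rw [hr, clamp_of_one_le (by norm_num), clamp_of_one_le (by norm_num), g_one]
  obtain ⟨G, hG, G_left, G_pt, hGF, hpG⟩ := exists_lift_square h' hF
    (fun x => by simp [F, clamp_of_nonpos le_rfl, f_zero])
    (fun x => by
      have : ¬ (((1 : unitInterval) : ℝ) ≤ 1 / 4) := by norm_num
      simp only [F, if_neg this]
      rw [clamp_of_nonpos (by simp), g_zero])
    (fun s => by simp only [F, f_pt, g_pt, ite_self]) hH H_left H_pt (by
      intro x r
      by_cases hr : (r : ℝ) ≤ 1 / 4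
      · rw [fan_one_of_le (by linarith)]
        simp only [F, if_pos hr, w]
      · simp only [F, if_neg hr, hpg]
        have hr₁ := r.2.2
        rw [coe_clamp (by linarith) (by linarith),
          show 1 - 3 / 4 * (4 / 3 * (1 - (r : ℝ))) = r by ring, clamp_coe])
  refine ⟨G, hG, ?_, fun x s => ?_, hpG⟩
  · rintro ⟨x, s⟩ (hz | hz) t <;> dsimp at hz <;> subst hz
    exacts [G_pt _ _, G_left _ _]
  · rw [← fan_bot, hGF]
    have : (clamp (s / 4 : ℝ) : ℝ) ≤ 1 / 4 := by rw [coe_clamp_div]; linarith [s.2.2]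
    simp only [F, if_pos this]
    rw [coe_clamp_div, mul_div_cancel₀ _ four_ne_zero, clamp_coe]

lemma susp_mk_zero (x : Space X) : (Quotient.mk _ (x, 0) : Space (susp X)) = pt (susp X) :=
  Quotient.sound (Or.inr ⟨Or.inr (Or.inl rfl), Or.inl rfl⟩)

lemma susp_mk_one (x : Space X) : (Quotient.mk _ (x, 1) : Space (susp X)) = pt (susp X) :=
  Quotient.sound (Or.inr ⟨Or.inr (Or.inr rfl), Or.inl rfl⟩)

lemma susp_mk_pt (s : unitInterval) : (Quotient.mk _ (pt X, s) : Space (susp X)) = pt (susp X) :=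
  Quotient.sound (Or.inr ⟨Or.inl rfl, Or.inl rfl⟩)

/-- The quotient map `X × I → ΣX`. -/
def suspMk (z : Space X × unitInterval) : Space (susp X) := Quotient.mk _ z

@[fun_prop]
lemma continuous_suspMk : Continuous (suspMk (X := X)) := continuous_quotient_mk'

/-- Fill the square with `a` on the bottom, `b` on the top and the base point on the right;
triviality of the left and right sides lets the filler descend to the suspension. -/
lemma homotopic_of_comp_susp (h : HasLiftingProperty (coneIncl (susp X)) p) {a b : susp X ⟶ E}
    (hab : Homotopic (a ≫ p) (b ≫ p)) : Homotopic a b := by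
  obtain ⟨K, hK, K_pt, K_zero, K_one⟩ := homotopic_iff.1 hab
  -- For r between 1/4 and 3/4 clamping puts both branches at the base point, so switching at 1/2 is
  -- harmless.
  let F : Space X × unitInterval → Space E := fun z =>
    if (z.2 : ℝ) ≤ 1 / 2 then toMap a (suspMk (z.1, clamp (4 * z.2)))
    else toMap b (suspMk (z.1, clamp (4 - 4 * z.2)))
  have a_one : ∀ x, toMap a (suspMk (x, 1)) = pt E := fun x =>
    (congrArg _ (susp_mk_one x)).trans (toMap_pt a)
  have b_one : ∀ x, toMap b (suspMk (x, 1)) = pt E := fun x =>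
    (congrArg _ (susp_mk_one x)).trans (toMap_pt b)
  have a_zero : ∀ x, toMap a (suspMk (x, 0)) = pt E := fun x =>
    (congrArg _ (susp_mk_zero x)).trans (toMap_pt a)
  have b_zero : ∀ x, toMap b (suspMk (x, 0)) = pt E := fun x =>
    (congrArg _ (susp_mk_zero x)).trans (toMap_pt b)
  have a_pt : ∀ s, toMap a (suspMk (pt X, s)) = pt E := fun x =>
    (congrArg _ (susp_mk_pt x)).trans (toMap_pt a)
  have b_pt : ∀ s, toMap b (suspMk (pt X, s)) = pt E := fun x =>
    (congrArg _ (susp_mk_pt x)).trans (toMap_pt b)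
  have K_right : ∀ x t, K (suspMk (x, 1), t) = pt B := fun x t =>
    (congrArg (fun y => K (y, t)) (susp_mk_one x)).trans (K_pt t)
  have hF : Continuous F := by
    refine Continuous.if_le (by fun_prop) (by fun_prop) (by fun_prop) (by fun_prop) ?_
    rintro ⟨x, r⟩ hr
    dsimp only at hr ⊢
    rw [hr, clamp_of_one_le (by norm_num), clamp_of_one_le (by norm_num), a_one, b_one]
  have F_mid : ∀ x (r : unitInterval), 1 ≤ 4 * (r : ℝ) → 4 * (r : ℝ) ≤ 3 → F (x, r) = pt E := by
    intro x r hr hr'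
    simp only [F]
    rw [clamp_of_one_le hr, clamp_of_one_le (by linarith), a_one, b_one, ite_self]
  obtain ⟨G, hG, G_left, G_pt, hGF, hpG⟩ := exists_lift_square h hF
    (fun x => by simp [F, clamp_of_nonpos le_rfl, a_zero])
    (fun x => by
      have : ¬ (((1 : unitInterval) : ℝ) ≤ 1 / 2) := by norm_num
      simp only [F, if_neg this]
      rw [clamp_of_nonpos (by simp), b_zero])
    (fun s => by simp only [F, a_pt, b_pt, ite_self])
    (H := fun z => K (suspMk (z.1, z.2.1), z.2.2)) (by fun_prop)
    (fun x t => (congrArg (fun y => K (y, t)) (susp_mk_zero x)).trans (K_pt t))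
    (fun s t => (congrArg (fun y => K (y, t)) (susp_mk_pt s)).trans (K_pt t)) (by
      intro x r
      obtain hr | hr := le_total (4 * (r : ℝ)) 1
      · rw [fan_one_of_le hr]
        have : (r : ℝ) ≤ 1 / 2 := by linarith
        simp only [F, if_pos this, K_zero, comp_apply]
      obtain hr' | hr' := le_total (4 * (r : ℝ)) 3
      · rw [fan_one_of_mem hr hr', F_mid x r hr hr', toMap_pt]
        exact (K_right _ _).symm
      · rw [fan_one_of_ge hr']
        have : ¬ (r : ℝ) ≤ 1 / 2 := by linarith
        simp only [F, if_neg this, K_one, comp_apply])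
  obtain ⟨G', hG', hG'G⟩ := exists_collapse_prod_desc (X := X)
    (S := {z | z.1 = pt X ∨ z.2 = 0 ∨ z.2 = 1}) hG (by
      rintro ⟨x, s⟩ (hz | hz | hz) t <;> dsimp at hz <;> subst hz
      · exact G_pt _ _
      · exact G_left _ _
      · dsimp only
        rw [← fan_right, hGF]
        exact F_mid _ _ (by rw [coe_clamp_right]; linarith [t.2.1])
          (by rw [coe_clamp_right]; linarith [t.2.2]))
  refine homotopic_iff.2 ⟨G', hG', fun t => (hG'G (pt X, 0) t).trans (G_pt _ _), fun q => ?_,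
    fun q => ?_⟩
  · obtain ⟨⟨x, s⟩, rfl⟩ := surjective_collapseMk _ q
    refine (hG'G _ _).trans ?_
    change G (x, s, 0) = toMap a (suspMk (x, s))
    rw [← fan_bot s, hGF]
    have : (clamp (s / 4 : ℝ) : ℝ) ≤ 1 / 2 := by rw [coe_clamp_div]; linarith [s.2.2]
    simp only [F, if_pos this]
    rw [coe_clamp_div, mul_div_cancel₀ _ four_ne_zero, clamp_coe]
  · obtain ⟨⟨x, s⟩, rfl⟩ := surjective_collapseMk _ q
    refine (hG'G _ _).trans ?_
    change G (x, s, 1) = toMap b (suspMk (x, s))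
    rw [← fan_top s, hGF]
    have : ¬ (clamp (1 - s / 4 : ℝ) : ℝ) ≤ 1 / 2 := by
      rw [coe_clamp_one_sub_div]; linarith [s.2.2]
    simp only [F, if_neg this]
    rw [coe_clamp_one_sub_div, show 4 - 4 * (1 - (s : ℝ) / 4) = s by ring, clamp_coe]

/-- A map out of ΣX is a map out of CX that is trivial on the base; lift it with the constant map
prescribed there. -/
lemma exists_comp_eq_susp (h : HasLiftingProperty (coneIncl X) p) (b : susp X ⟶ B) :
    ∃ a : susp X ⟶ E, a ≫ p = b := by
  obtain ⟨G, hG, G_zero, G_pt, G_one, hpG⟩ := exists_lift_cone h (f := fun _ => pt E)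
    continuous_const rfl (H := fun z => toMap b (suspMk z)) (by fun_prop)
    (fun x => (congrArg _ (susp_mk_zero x)).trans (toMap_pt b))
    (fun s => (congrArg _ (susp_mk_pt s)).trans (toMap_pt b))
    (fun x => (toMap_pt p).trans ((congrArg _ (susp_mk_one x)).trans (toMap_pt b)).symm)
  obtain ⟨a, ha⟩ := exists_collapse_desc (X := X) (S := {z | z.1 = pt X ∨ z.2 = 0 ∨ z.2 = 1})
    (Or.inl rfl) hG (by
      rintro ⟨x, s⟩ (hz | hz | hz) <;> dsimp at hz <;> subst hz
      exacts [G_pt _, G_zero _, G_one _])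
  exact ⟨a, collapseSpace_hom_ext (X := X) (S := {z | z.1 = pt X ∨ z.2 = 0 ∨ z.2 = 1}) fun z =>
    (congrArg _ (ha z)).trans (hpG z)⟩

lemma homotopic_const_of_comp (h : HasLiftingProperty (coneIncl X) p) {a : X ⟶ E}
    (ha : Homotopic (a ≫ p) (const X B)) : Homotopic a (const X E) := by
  obtain ⟨K, hK, K_zero, K_pt, K_one⟩ := homotopic_const_iff.1 ha
  obtain ⟨G, hG, G_zero, G_pt, G_one, -⟩ := exists_lift_cone h (toMap a).continuous
    (toMap_pt a) hK K_zero K_pt fun x => (K_one x).symm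
  exact homotopic_const_iff.2 ⟨G, hG, G_zero, G_pt, G_one⟩

lemma HasHLP.exists_comp_eq (h : HasHLP p X) {a : X ⟶ E} {b : X ⟶ B}
    (hab : Homotopic (a ≫ p) b) : ∃ a' : X ⟶ E, a' ≫ p = b := by
  obtain ⟨K, hK, K_pt, K_zero, K_one⟩ := homotopic_iff.1 hab
  obtain ⟨G, hG, G_pt, G_zero, hpG⟩ := h.exists_lift (toMap a).continuous (toMap_pt a) hK K_pt
    fun x => (K_zero x).symm
  exact ⟨ofMap ⟨fun x => G (x, 1), by fun_prop⟩ (G_pt 1),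
    hom_ext fun x => (hpG (x, 1)).trans (K_one x)⟩

end Lift

/-! ### Lifts against the inclusion of the base of a cone -/

section Lift

variable {X E B : PtdTop.{u}} {p : E ⟶ B}

/-- A null-homotopy `K` of `a` extends `a` over the cone, but may lie over the wrong map. The
discrepancy, `V` followed by the reverse of `p ∘ K`, is a map `d` on ΣX. Prefixing `K` with a lift
of `d` gives an extension whose image is homotopic to `V` relative to the base. -/
lemma hasLiftingProperty_coneIncl (hC : HasHLP p (cone X))
    (hinj : ∀ a : X ⟶ E, Homotopic (a ≫ p) (const X B) → Homotopic a (const X E))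
    (hsurj : ∀ b : susp X ⟶ B, ∃ a : susp X ⟶ E, a ≫ p = b) :
    HasLiftingProperty (coneIncl X) p := by
  refine ⟨fun {a v} sq => ?_⟩
  let S : Set (Space X × unitInterval) := {z | z.1 = pt X ∨ z.2 = 0}
  let S' : Set (Space X × unitInterval) := {z | z.1 = pt X ∨ z.2 = 0 ∨ z.2 = 1}
  obtain ⟨V, hV, V_zero, V_pt, V_one, V_mk⟩ : ∃ V : Space X × unitInterval → Space B,
      Continuous V ∧ (∀ x, V (x, 0) = pt B) ∧ (∀ s, V (pt X, s) = pt B) ∧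
        (∀ x, V (x, 1) = toMap p (toMap a x)) ∧ ∀ z, V z = toMap v (collapseMk S z) :=
    ⟨fun z => toMap v (collapseMk S z), (toMap v).continuous.comp (continuous_collapseMk S),
      fun x => (congrArg _ (collapseMk_of_mem (Or.inl rfl) (Or.inr rfl))).trans (toMap_pt v),
      fun s => (congrArg _ (collapseMk_of_mem (Or.inl rfl) (Or.inl rfl))).trans (toMap_pt v),
      fun x => (congr_toMap sq.w x).symm, fun _ => rfl⟩
  obtain ⟨K, hK, K_zero, K_pt, K_one⟩ := homotopic_const_iff.1
    (hinj a (homotopic_const_iff.2 ⟨V, hV, V_zero, V_pt, V_one⟩))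
  let d : Space X × unitInterval → Space B := fun z =>
    if (z.2 : ℝ) ≤ 1 / 2 then V (z.1, clamp (2 * z.2))
    else toMap p (K (z.1, clamp (2 - 2 * z.2)))
  have hd : Continuous d := by
    refine Continuous.if_le (by fun_prop) (by fun_prop) (by fun_prop) (by fun_prop) ?_
    rintro ⟨x, r⟩ hr
    dsimp only at hr ⊢
    rw [hr, clamp_of_one_le (by norm_num), clamp_of_one_le (by norm_num), V_one, K_one]
  obtain ⟨d', hd'⟩ := exists_collapse_desc (X := X) (S := S') (Or.inl rfl) hd (by
    rintro ⟨x, s⟩ (hz | hz | hz) <;> dsimp at hz <;> subst hz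
    · simp only [d, V_pt, K_pt, toMap_pt, ite_self]
    · simp [d, clamp_of_nonpos le_rfl, V_zero]
    · have : ¬ (((1 : unitInterval) : ℝ) ≤ 1 / 2) := by norm_num
      simp only [d, if_neg this]
      rw [clamp_of_nonpos (by simp), K_zero, toMap_pt])
  obtain ⟨l, hl⟩ := hsurj d'
  obtain ⟨L, hL, L_zero, L_one, L_pt, hpL⟩ : ∃ L : Space X × unitInterval → Space E,
      Continuous L ∧ (∀ x, L (x, 0) = pt E) ∧ (∀ x, L (x, 1) = pt E) ∧
        (∀ s, L (pt X, s) = pt E) ∧ ∀ z, toMap p (L z) = d z :=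
    ⟨fun z => toMap l (suspMk z), by fun_prop,
      fun x => (congrArg _ (susp_mk_zero x)).trans (toMap_pt l),
      fun x => (congrArg _ (susp_mk_one x)).trans (toMap_pt l),
      fun s => (congrArg _ (susp_mk_pt s)).trans (toMap_pt l),
      fun z => (congr_toMap hl (suspMk z)).trans (hd' z)⟩
  let f : Space X × unitInterval → Space E := fun z =>
    if 3 * (z.2 : ℝ) ≤ 2 then L (z.1, clamp (3 * z.2 / 2)) else K (z.1, clamp (3 * z.2 - 2))
  have hf : Continuous f := by
    refine Continuous.if_le (by fun_prop) (by fun_prop) (by fun_prop) (by fun_prop) ?_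
    rintro ⟨x, r⟩ hr
    dsimp only at hr ⊢
    rw [hr, clamp_of_one_le (by norm_num), clamp_of_nonpos (by norm_num), L_one, K_zero]
  -- At t = 0 this is `V`, then `p ∘ K` backwards, then `p ∘ K` forwards, each on a third of the
  -- interval. Increasing t cancels the last two parts, leaving `V` at t = 1; at s = 1 the value
  -- stays `p ∘ a`.
  let H : Space X × unitInterval × unitInterval → Space B := fun z =>
    if (z.2.1 : ℝ) * (3 - 2 * z.2.2) ≤ 1 then V (z.1, clamp (z.2.1 * (3 - 2 * z.2.2)))
    else toMap p (K (z.1, clamp (|3 * (z.2.1 : ℝ) - 2| + 2 * z.2.2)))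
  have hH : Continuous H := by
    refine Continuous.if_le (by fun_prop) (by fun_prop) (by fun_prop) (by fun_prop) ?_
    rintro ⟨x, s, t⟩ hr
    dsimp only at hr ⊢
    have ht₀ := t.2.1
    have ht₁ := t.2.2
    have h₁ : 3 * (s : ℝ) ≤ 1 + 2 * t := by
      by_contra! h
      nlinarith
    rw [hr, clamp_of_one_le le_rfl,
      clamp_of_one_le (by linarith [neg_abs_le (3 * (s : ℝ) - 2)]), V_one, K_one]
  obtain ⟨G, hG, G_left, G_right, G_pt, -, hpG⟩ := hC.exists_lift_cone_rel hf
    (fun x => by simp [f, clamp_of_nonpos le_rfl, L_zero])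
    (fun s => by simp only [f, L_pt, K_pt, ite_self]) hH
    (fun x t => by simp [H, clamp_of_nonpos le_rfl, V_zero])
    (by
      have : ∀ x t, H (x, 1, t) = toMap p (toMap a x) := by
        intro x t
        simp only [H, Set.Icc.coe_one]
        have ht₀ := t.2.1
        have ht₁ := t.2.2
        rw [clamp_of_one_le (by linarith), clamp_of_one_le, V_one, K_one, ite_self]
        rw [abs_of_pos (by norm_num)]
        linarith
      intro x t
      rw [this, this])
    (fun s t => by simp only [H, V_pt, K_pt, toMap_pt, ite_self]) (by
      intro x s
      have hs₀ := s.2.1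
      have hs₁ := s.2.2
      simp only [H, f, Set.Icc.coe_zero, mul_zero, sub_zero, add_zero]
      obtain h | h := le_or_gt (3 * (s : ℝ)) 2
      · rw [if_pos h, hpL]
        simp only [d]
        rw [coe_clamp (by linarith) (by linarith)]
        obtain h' | h' := le_or_gt (3 * (s : ℝ)) 1
        · rw [if_pos (by linarith), if_pos (by linarith)]
          congr 3
          ring
        · rw [if_neg (by linarith), if_neg (by linarith), abs_of_nonpos (by linarith)]
          congr 4
          ring
      · rw [if_neg (by linarith), if_neg (by linarith), abs_of_nonneg (by linarith)])
  obtain ⟨g, hg⟩ := exists_collapse_desc (X := X) (S := S) (Or.inl rfl)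
    (f := fun z => G (z.1, z.2, 1)) (by fun_prop) (by
      rintro ⟨x, s⟩ (hz | hz) <;> dsimp at hz <;> subst hz
      exacts [G_pt _ _, G_left _ _])
  refine ⟨⟨⟨g, hom_ext fun x => ?_, collapseSpace_hom_ext (X := X) (S := S) fun z => ?_⟩⟩⟩
  · refine ((hg (x, 1)).trans (G_right _ _)).trans ?_
    have : ¬ (3 * ((1 : unitInterval) : ℝ) ≤ 2) := by norm_num
    simp only [f, if_neg this]
    rw [clamp_of_one_le (by norm_num), K_one]
  · refine ((congrArg _ (hg z)).trans (hpG _)).trans ?_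
    obtain ⟨x, s⟩ := z
    have h : (s : ℝ) * (3 - 2 * ((1 : unitInterval) : ℝ)) = s := by norm_num
    simp only [H, h]
    rw [if_pos s.2.2, clamp_coe]
    exact V_mk _

end Lift

/-! ### Path spaces -/

section Path

/-- The space of unpointed paths in `Y`, pointed at the constant path. -/
def pathSpace (Y : PtdTop.{u}) : PtdTop.{u} :=
  of C(unitInterval, Space Y) (ContinuousMap.const _ (pt Y))

/-- The evaluation of paths. -/
def pathEval (Y : PtdTop.{u}) (t : unitInterval) : pathSpace Y ⟶ Y :=
  ofMap (X := pathSpace Y) ⟨fun γ : C(unitInterval, Space Y) => γ t, by fun_prop⟩ rfl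

/-- The product `Y × Y`. -/
def square (Y : PtdTop.{u}) : PtdTop.{u} := of (Space Y × Space Y) (pt Y, pt Y)

/-- The map that sends a path to its end points. -/
def pathEnds (Y : PtdTop.{u}) : pathSpace Y ⟶ square Y :=
  ofMap (X := pathSpace Y) (Y := square Y)
    ⟨fun γ : C(unitInterval, Space Y) => (γ 0, γ 1), by fun_prop⟩ rfl

variable {X Y : PtdTop.{u}}

/-- The exponential law for the interval. In this form homotopies can be precomposed and assembled
on coproducts formally. -/
lemma homotopic_iff_exists_path {f g : X ⟶ Y} :
    Homotopic f g ↔ ∃ h : X ⟶ pathSpace Y, h ≫ pathEval Y 0 = f ∧ h ≫ pathEval Y 1 = g := by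
  rw [homotopic_iff]
  constructor
  · rintro ⟨K, hK, K_pt, K_zero, K_one⟩
    exact ⟨ofMap (Y := pathSpace Y) (ContinuousMap.curry ⟨K, hK⟩) (ContinuousMap.ext K_pt),
      hom_ext K_zero, hom_ext K_one⟩
  · rintro ⟨h, rfl, rfl⟩
    let k : C(Space X, C(unitInterval, Space Y)) := toMap h
    exact ⟨fun z => k z.1 z.2, by fun_prop,
      fun s => congrArg (fun γ : C(unitInterval, Space Y) => γ s) (toMap_pt h),
      fun _ => rfl, fun _ => rfl⟩

lemma Homotopic.comp_left {Z : PtdTop.{u}} (k : Z ⟶ X) {f g : X ⟶ Y} (h : Homotopic f g) :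
    Homotopic (k ≫ f) (k ≫ g) := by
  obtain ⟨l, rfl, rfl⟩ := homotopic_iff_exists_path.1 h
  exact homotopic_iff_exists_path.2 ⟨k ≫ l, by simp, by simp⟩

lemma hasHLP_pathEnds (X Y : PtdTop.{u}) : HasHLP (pathEnds Y) X := by
  refine hasHLP_of_exists_lift fun {f} hf f_pt {H} hH H_pt w => ?_
  let f' : Space X → C(unitInterval, Space Y) := f
  let H' : Space X × unitInterval → Space Y × Space Y := H
  have hf' : Continuous f' := hf
  have hH' : Continuous H' := hH
  have w₀ : ∀ x, f' x 0 = (H' (x, 0)).1 := fun x =>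
    congrArg (fun y : Space Y × Space Y => y.1) (w x)
  have w₁ : ∀ x, f' x 1 = (H' (x, 0)).2 := fun x =>
    congrArg (fun y : Space Y × Space Y => y.2) (w x)
  have H'_pt : ∀ s, H' (pt X, s) = (pt Y, pt Y) := H_pt
  have f'_pt : ∀ s, f' (pt X) s = pt Y := fun s =>
    congrArg (fun γ : C(unitInterval, Space Y) => γ s) f_pt
  -- For fixed t this maps [0, 1] affinely onto [−t, 1 + t]: the original path occupies [0, 1], and
  -- the two tails follow the homotopies of its end points.
  let r : (Space X × unitInterval) × unitInterval → ℝ := fun z => (1 + 2 * z.1.2) * z.2 - z.1.2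
  have hr : Continuous r := by fun_prop
  let K : (Space X × unitInterval) × unitInterval → Space Y := fun z =>
    if r z ≤ 0 then (H' (z.1.1, clamp (-r z))).1
    else if r z ≤ 1 then f' z.1.1 (clamp (r z)) else (H' (z.1.1, clamp (r z - 1))).2
  have hK : Continuous K := by
    refine Continuous.if_le (by fun_prop) (Continuous.if_le (by fun_prop) (by fun_prop)
      (by fun_prop) (by fun_prop) ?_) (by fun_prop) (by fun_prop) ?_
    · intro z hz
      rw [hz, clamp_of_one_le le_rfl, clamp_of_nonpos (by norm_num), w₁]
    · intro z hz
      rw [hz, if_pos zero_le_one, neg_zero, clamp_of_nonpos le_rfl, w₀]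
  refine ⟨fun z => ContinuousMap.curry ⟨K, hK⟩ z, (ContinuousMap.curry ⟨K, hK⟩).continuous,
    fun t => ContinuousMap.ext fun s => ?_, fun x => ContinuousMap.ext fun s => ?_, fun z => ?_⟩
  · change K ((pt X, t), s) = pt Y
    simp only [K, H'_pt, f'_pt, ite_self]
  · change K ((x, 0), s) = f' x s
    have h : r ((x, 0), s) = s := by simp [r]
    simp only [K, h]
    rw [if_pos s.2.2, clamp_coe]
    split_ifs with hs
    · obtain rfl : s = 0 := Subtype.ext (le_antisymm hs s.2.1)
      rw [w₀, clamp_of_nonpos (by simp)]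
    · rfl
  · obtain ⟨x, t⟩ := z
    have ht := t.2.1
    change (K ((x, t), 0), K ((x, t), 1)) = H' (x, t)
    refine Prod.ext ?_ ?_
    · have h : r ((x, t), 0) = -t := by simp [r]
      simp only [K, h]
      rw [if_pos (by linarith), neg_neg, clamp_coe]
    · have h : r ((x, t), 1) = 1 + t := by
        simp only [r, Set.Icc.coe_one]
        ring
      simp only [K, h]
      rw [if_neg (by linarith), add_sub_cancel_left, clamp_coe]
      split_ifs with ht'
      · obtain rfl : t = 0 := Subtype.ext (by simp only [Set.Icc.coe_zero]; linarith)
        rw [clamp_of_one_le (by simp), w₁]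
      · rfl

lemma hasHLP_const_point (X Y : PtdTop.{u}) : HasHLP (const Y point) X :=
  hasHLP_of_exists_lift fun {f} hf f_pt _ _ _ _ =>
    ⟨fun z => f z.1, by fun_prop, fun _ => f_pt, fun _ => rfl, fun _ => rfl⟩

lemma fibrationsA_of_forall_hasHLP {A E B : PtdTop.{u}} {p : E ⟶ B} (h : ∀ X, HasHLP p X) :
    fibrationsA A p :=
  ⟨h _, fun _ => h _, fun _ => h _⟩

/-- Lifting against `X ⟶ point` gives a retraction `r`; lifting against the end point map, starting
from constant paths, gives a homotopy from `r ≫ f` to the identity. So `f` is a pointed homotopy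
equivalence. -/
lemma llp_fibrationsA_le_weakEquivalencesA (A : PtdTop.{u}) :
    (fibrationsA A).llp ≤ weakEquivalencesA A := by
  intro X Y f hf n
  have h₁ := hf _ (fibrationsA_of_forall_hasHLP fun Z => hasHLP_const_point Z X)
  have h₂ := hf _ (fibrationsA_of_forall_hasHLP fun Z => hasHLP_pathEnds Z Y)
  obtain ⟨r, hr⟩ := exists_lift_of_llp (i := f) (𝟙 X)
  let c : X ⟶ pathSpace Y := ofMap (Y := pathSpace Y) ⟨fun x => ContinuousMap.const _ (toMap f x),
    by fun_prop⟩ (congrArg (ContinuousMap.const unitInterval) (toMap_pt f))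
  let e : Y ⟶ square Y := ofMap (Y := square Y) ⟨fun y => (toMap f (toMap r y), y), by fun_prop⟩
    (Prod.ext ((congrArg (toMap f) (toMap_pt r)).trans (toMap_pt f)) rfl)
  have sq : CommSq c f (pathEnds Y) e := ⟨hom_ext fun x => by
    have h := congr_toMap hr x
    refine Prod.ext ?_ rfl
    exact (congrArg (toMap f) h).symm⟩
  have hrf : Homotopic (r ≫ f) (𝟙 Y) := homotopic_iff_exists_path.2 ⟨sq.lift,
    hom_ext fun y => congrArg (fun z : Space Y × Space Y => z.1) (congr_toMap sq.fac_right y),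
    hom_ext fun y => congrArg (fun z : Space Y × Space Y => z.2) (congr_toMap sq.fac_right y)⟩
  constructor
  · rintro ⟨a⟩ ⟨b⟩ hab
    have h : Homotopic (a ≫ f) (b ≫ f) := Quotient.exact hab
    have h' := h.comp_right r
    rw [Category.assoc, Category.assoc, hr, Category.comp_id, Category.comp_id] at h'
    exact Quotient.sound h'
  · rintro ⟨b⟩
    refine ⟨Quotient.mk _ (b ≫ r), Quotient.sound ?_⟩
    have h := hrf.comp_left b
    rw [Category.comp_id, ← Category.assoc] at h
    exact h

end Path

/-! ### The multiplication on homotopy classes of maps out of an H-cogroup -/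

section HCogroup

variable {A E B : PtdTop.{u}}

lemma Homotopic.coprod_desc {a a' b b' : A ⟶ E} (ha : Homotopic a a') (hb : Homotopic b b') :
    Homotopic (coprod.desc a b) (coprod.desc a' b') := by
  obtain ⟨h, rfl, rfl⟩ := homotopic_iff_exists_path.1 ha
  obtain ⟨k, rfl, rfl⟩ := homotopic_iff_exists_path.1 hb
  exact homotopic_iff_exists_path.2 ⟨coprod.desc h k, by simp, by simp⟩

lemma Homotopic.trans' {X Y : PtdTop.{u}} {f g h : X ⟶ Y} (h₁ : Homotopic f g)
    (h₂ : Homotopic g h) : Homotopic f h :=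
  (homotopySetoid X Y).trans h₁ h₂

lemma Homotopic.symm' {X Y : PtdTop.{u}} {f g : X ⟶ Y} (h₁ : Homotopic f g) : Homotopic g f :=
  (homotopySetoid X Y).symm h₁

lemma Homotopic.refl' {X Y : PtdTop.{u}} (f : X ⟶ Y) : Homotopic f f :=
  (homotopySetoid X Y).refl f

lemma coprod_associator_desc {C : Type*} [Category* C] [HasBinaryCoproducts C] {X Y Z T : C}
    (a : X ⟶ T) (b : Y ⟶ T) (c : Z ⟶ T) :
    (coprod.associator X Y Z).hom ≫ coprod.desc a (coprod.desc b c) =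
      coprod.desc (coprod.desc a b) c := by
  have h₁ : coprod.inl ≫ coprod.desc b c = b := coprod.inl_desc b c
  have h₂ : coprod.inr ≫ coprod.desc b c = c := coprod.inr_desc b c
  have h₃ : coprod.inr ≫ coprod.desc a (coprod.desc b c) = _ := coprod.inr_desc a _
  have h₄ : coprod.inl ≫ coprod.desc a (coprod.desc b c) = _ := coprod.inl_desc a _
  simp only [coprod.associator_hom, coprod.desc_comp, Category.assoc, h₁, h₂, h₃, h₄]

lemma coprod_map_associator_desc {C : Type*} [Category* C] [HasBinaryCoproducts C]
    {X Y Z T V : C} (f : V ⟶ X ⨿ Y) (a : X ⟶ T) (b : Y ⟶ T) (c : Z ⟶ T) :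
    coprod.map f (𝟙 Z) ≫ (coprod.associator X Y Z).hom ≫ coprod.desc a (coprod.desc b c) =
      coprod.desc (f ≫ coprod.desc a b) c := by
  rw [coprod_associator_desc, coprod.map_desc, Category.id_comp]

/-- The group argument for trivial kernels, carried out on representatives: a·b⁻¹ is killed by `p`,
hence trivial, and a ≃ a·(b⁻¹·b) ≃ (a·b⁻¹)·b ≃ b. -/
lemma IsHCogroup.homotopic_of_comp (hA : IsHCogroup A) {p : E ⟶ B}
    (hp : ∀ a : A ⟶ E, Homotopic (a ≫ p) (const A B) → Homotopic a (const A E)) {a b : A ⟶ E}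
    (hab : Homotopic (a ≫ p) (b ≫ p)) : Homotopic a b := by
  obtain ⟨μ, ν, counit_left, counit_right, coassoc, inv_left, inv_right⟩ := hA
  have one_mul : Homotopic (μ ≫ coprod.desc (const A E) b) b := by
    simpa using counit_left.comp_right b
  have mul_one : Homotopic (μ ≫ coprod.desc a (const A E)) a := by
    simpa using counit_right.comp_right a
  have inv_mul : Homotopic (μ ≫ coprod.desc (ν ≫ b) b) (const A E) := by
    simpa using inv_left.comp_right b
  have mul_inv : Homotopic (μ ≫ coprod.desc (b ≫ p) (ν ≫ b ≫ p)) (const A B) := by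
    simpa using inv_right.comp_right (b ≫ p)
  have mul_assoc : Homotopic (μ ≫ coprod.desc (μ ≫ coprod.desc a (ν ≫ b)) b)
      (μ ≫ coprod.desc a (μ ≫ coprod.desc (ν ≫ b) b)) := by
    have h := coassoc.comp_right (coprod.desc a (coprod.desc (ν ≫ b) b))
    simp only [Category.assoc, coprod.map_desc, Category.id_comp] at h
    rwa [coprod_map_associator_desc] at h
  have h₁ : Homotopic (μ ≫ coprod.desc a (ν ≫ b)) (const A E) := by
    apply hp
    have := (hab.coprod_desc (Homotopic.refl' (ν ≫ b ≫ p))).comp_left μ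
    simpa using this.trans' mul_inv
  exact mul_one.symm'.trans' ((((Homotopic.refl' a).coprod_desc inv_mul.symm').comp_left μ).trans'
    (mul_assoc.symm'.trans' (((h₁.coprod_desc (Homotopic.refl' b)).comp_left μ).trans' one_mul)))

end HCogroup

/-! ### The generating maps are embeddings -/

section Embedding

lemma llp_embeddingTests_i₀ (X : PtdTop.{u}) : embeddingTests.llp (i₀ X) := by
  obtain ⟨r, hr⟩ := exists_collapse_desc (X := X) (Y := X) (S := {z | z.1 = pt X}) rfl
    continuous_fst fun z hz => hz
  exact llp_of_isEmbedding (Function.LeftInverse.isEmbedding (f := toMap r)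
    (fun x => hr (x, 0)) (toMap r).continuous (toMap (i₀ X)).continuous)

lemma llp_embeddingTests_coneIncl (W : PtdTop.{u}) : embeddingTests.llp (coneIncl W) := by
  let S : Set (Space W × unitInterval) := {z | z.1 = pt W ∨ z.2 = 0}
  intro _ _ _ h
  obtain a | a := h
  · refine hasLiftingProperty_const_point fun f => ?_
    let f' : Space W → ULift.{u} Prop := toMap f
    have f'_pt : f' (pt W) = ⟨a⟩ := toMap_pt f
    classical
    obtain ⟨g, hg⟩ := exists_collapse_desc (X := W) (Y := indiscrete.{u} a) (S := S) (Or.inl rfl)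
      (f := fun z => if z.2 = 1 then f' z.1 else (⟨a⟩ : ULift.{u} Prop)) continuous_top (by
        rintro ⟨x, s⟩ (hz | hz) <;> dsimp at hz <;> subst hz
        · dsimp only
          rw [f'_pt]
          exact ite_self _
        · exact if_neg zero_ne_one)
    exact ⟨g, hom_ext fun x => (hg (x, 1)).trans (if_pos rfl)⟩
  · refine hasLiftingProperty_const_point fun f => ?_
    let f' : Space W → Prop := fun x => (toMap f x : ULift.{u} Prop).down
    have hf' : IsOpen {x | f' x} :=
      continuous_Prop.1 (continuous_uliftDown.comp (toMap f).continuous)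
    have f'_pt : f' (pt W) = a := congrArg ULift.down (toMap_pt f)
    have h₁ : IsOpen {z : Space W × unitInterval | f' z.1} := hf'.preimage continuous_fst
    have h₂ : IsOpen {z : Space W × unitInterval | z.2 < 1} :=
      isOpen_lt continuous_snd continuous_const
    have h₃ : IsOpen {z : Space W × unitInterval | 0 < z.2} :=
      isOpen_lt continuous_const continuous_snd
    -- For an open U ⊆ W this encodes two extensions at once: U × (0, 1] if the base point is
    -- outside U, and U × I ∪ W × [0, 1) if it is inside.
    obtain ⟨g, hg⟩ := exists_collapse_desc (X := W) (Y := sierpinski.{u} a) (S := S) (Or.inl rfl)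
      (f := fun z => (⟨(f' z.1 ∨ a ∧ z.2 < 1) ∧ (a ∨ 0 < z.2)⟩ : ULift.{u} Prop))
      (by
        refine continuous_uliftUp.comp (continuous_Prop.2 ?_)
        exact (h₁.union (isOpen_const.inter h₂)).inter (isOpen_const.union h₃)) (by
        rintro ⟨x, s⟩ (hz | hz) <;> dsimp at hz <;> subst hz
        · refine ULift.down_injective (propext ?_)
          change ((f' (pt W) ∨ a ∧ s < 1) ∧ (a ∨ 0 < s)) ↔ a
          rw [f'_pt]
          tauto
        · refine ULift.down_injective (propext ?_)
          change ((f' x ∨ a ∧ (0 : unitInterval) < 1) ∧ (a ∨ (0 : unitInterval) < 0)) ↔ a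
          have : (0 : unitInterval) < 1 := zero_lt_one
          have : ¬ (0 : unitInterval) < 0 := lt_irrefl _
          tauto)
    refine ⟨g, hom_ext fun x => (hg (x, 1)).trans (ULift.down_injective (propext ?_))⟩
    change ((f' x ∨ a ∧ (1 : unitInterval) < 1) ∧ (a ∨ (0 : unitInterval) < 1)) ↔ f' x
    have : (0 : unitInterval) < 1 := zero_lt_one
    have : ¬ (1 : unitInterval) < 1 := lt_irrefl _
    tauto

lemma llp_embeddingTests_const_point (A : PtdTop.{u}) : embeddingTests.llp (const point A) := by
  intro _ _ _ h
  obtain a | a := h <;>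
  exact hasLiftingProperty_const_point fun f => ⟨const _ _, by rw [comp_const, eq_const_of_point f]⟩

lemma genCofibrations_le (A : PtdTop.{u}) : genCofibrations A ≤ embeddingTests.llp := by
  rintro _ _ _ (n | n | _)
  exacts [llp_embeddingTests_coneIncl _, llp_embeddingTests_i₀ _, llp_embeddingTests_const_point _]

lemma genTrivialCofibrations_le (A : PtdTop.{u}) :
    genTrivialCofibrations A ≤ embeddingTests.llp := by
  rintro _ _ _ (n | n)
  exacts [llp_embeddingTests_i₀ _, llp_embeddingTests_i₀ _]

end Embedding

/-! ### The trivial fibrations -/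

section TrivialFibrations

variable {A E B : PtdTop.{u}} {p : E ⟶ B}

lemma fibrationsA_of_rlp (h : (genCofibrations A).rlp p) : fibrationsA A p :=
  ⟨hasHLP_iff.2 (h _ (.cyl 0)), fun n => hasHLP_cone (h _ (.cone n)) (h _ (.cone (n + 1))),
    fun n => hasHLP_iff.2 (h _ (.cyl (n + 1)))⟩

lemma weakEquivalencesA_of_rlp (hA : IsHCogroup A) (h : (genCofibrations A).rlp p) :
    weakEquivalencesA A p := by
  intro n
  cases n with
  | zero =>
    constructor
    · rintro ⟨a⟩ ⟨b⟩ hab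
      exact Quotient.sound (hA.homotopic_of_comp
        (fun _ => homotopic_const_of_comp (h _ (.cone 0))) (Quotient.exact hab))
    · rintro ⟨(b : A ⟶ B)⟩
      have := h _ .point
      have sq : CommSq (const point E) (const point A) p b := ⟨by
        rw [const_comp, eq_const_of_point (const point A ≫ b)]⟩
      exact ⟨Quotient.mk _ sq.lift, congrArg (Quotient.mk _) sq.fac_right⟩
  | succ n =>
    constructor
    · rintro ⟨a⟩ ⟨b⟩ hab
      exact Quotient.sound (homotopic_of_comp_susp (h _ (.cone (n + 1))) (Quotient.exact hab))
    · rintro ⟨b⟩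
      obtain ⟨a, ha⟩ := exists_comp_eq_susp (h _ (.cone n)) b
      exact ⟨Quotient.mk _ a, congrArg (Quotient.mk _) ha⟩

lemma rlp_of_fibrationsA_of_weakEquivalencesA (hp : fibrationsA A p)
    (hw : weakEquivalencesA A p) : (genCofibrations A).rlp p := by
  have hsurj : ∀ n, HasHLP p (suspIter A n) → ∀ b : suspIter A n ⟶ B,
      ∃ a : suspIter A n ⟶ E, a ≫ p = b := by
    intro n hn b
    obtain ⟨⟨a⟩, ha⟩ := (hw n).2 (Quotient.mk _ b)
    -- Surjectivity on classes lifts `b` only up to homotopy; lifting that homotopy makes the lift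
    -- strict.
    exact hn.exists_comp_eq (Quotient.exact ha)
  rintro _ _ _ (n | n | _)
  · refine hasLiftingProperty_coneIncl (hp.2.1 n) (fun a ha => ?_)
      (hsurj (n + 1) (hp.2.1 n).susp)
    refine Quotient.exact ((hw n).1 (Quotient.sound ?_))
    change Homotopic (a ≫ p) (const _ E ≫ p)
    rwa [const_comp]
  · rw [fibrationsA_eq_rlp] at hp
    exact hp _ (.cyl n)
  · refine ⟨fun {f b} sq => ?_⟩
    obtain ⟨a, ha⟩ := hsurj 0 hp.1 b
    exact ⟨⟨⟨a, (eq_const_of_point _).trans (eq_const_of_point f).symm, ha⟩⟩⟩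

lemma rlp_genCofibrations (hA : IsHCogroup A) :
    (genCofibrations A).rlp = fibrationsA A ⊓ weakEquivalencesA A :=
  le_antisymm (fun _ _ _ h => ⟨fibrationsA_of_rlp h, weakEquivalencesA_of_rlp hA h⟩)
    fun _ _ _ h => rlp_of_fibrationsA_of_weakEquivalencesA h.1 h.2

end TrivialFibrations

end PtdTop

/-! ### Assembly of the model structure -/

theorem mainTheorem1 (A : PtdTop.{u}) [CompactSpace (PtdTop.Space A)] [T1Space (PtdTop.Space A)]
    (hA : PtdTop.IsHCogroup A) :
    HasLimits PtdTop.{u} ∧ HasColimits PtdTop.{u} ∧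
    ∃ _ : ModelCategory PtdTop.{u},
      fibrations PtdTop.{u} = PtdTop.fibrationsA A ∧
      cofibrations PtdTop.{u} = PtdTop.cofibrationsA A ∧
      weakEquivalences PtdTop.{u} = PtdTop.weakEquivalencesA A ∧
      MorphismProperty.HasFunctorialFactorization
        (cofibrations PtdTop.{u}) (trivialFibrations PtdTop.{u}) ∧
      MorphismProperty.HasFunctorialFactorization
        (trivialCofibrations PtdTop.{u}) (fibrations PtdTop.{u}) ∧
      IsCofibrantlyGeneratedBy.{u} PtdTop.{u}
        (PtdTop.genCofibrations A) (PtdTop.genTrivialCofibrations A) := by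
  have hI := PtdTop.genCofibrations_le A
  have hJ := PtdTop.genTrivialCofibrations_le A
  have := PtdTop.hasSmallObjectArgument hI
  have := PtdTop.hasSmallObjectArgument hJ
  have hfib := PtdTop.fibrationsA_eq_rlp (A := A)
  have htriv := PtdTop.rlp_genCofibrations hA
  have h₁ : (PtdTop.genCofibrations A).rlp =
      (PtdTop.genTrivialCofibrations A).rlp ⊓ PtdTop.weakEquivalencesA A := hfib ▸ htriv
  have h₂ : (PtdTop.genTrivialCofibrations A).rlp.llp ≤ PtdTop.weakEquivalencesA A :=
    hfib ▸ PtdTop.llp_fibrationsA_le_weakEquivalencesA A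
  refine ⟨inferInstance, inferInstance, ?_⟩
  obtain ⟨M, hF, hC, hW⟩ := exists_modelCategory h₁ h₂
  have hTF : trivialFibrations PtdTop.{u} = (PtdTop.genCofibrations A).rlp := by
    rw [trivialFibrations, hF, hW, h₁]
  have hTC : trivialCofibrations PtdTop.{u} = (PtdTop.genTrivialCofibrations A).rlp.llp := by
    rw [trivialCofibrations, hC, hW]
    exact inf_eq_rlp_llp_of_rlp_eq h₁ h₂
  refine ⟨M, hF.trans hfib.symm, hC.trans ?_, hW, ?_, ?_,
    ⟨inferInstance, inferInstance, PtdTop.permitsSmallObjectArgument hI,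
      PtdTop.permitsSmallObjectArgument hJ, hTF, hF⟩⟩
  · rw [htriv]
    rfl
  · rw [hC, hTF]
    infer_instance
  · rw [hTC, hF]
    infer_instance
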